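/- Let $\theta_a,\theta_b\in(-\frac{\pi}{2},\frac{\pi}{2})$. Let $S$ be the Fibonacci substitution $a\mapsto ab$, $b\mapsto a$, let $s_k=S^k(a)$ for $k\ge 0$, let $u=abaababa\ldots$ be the one-sided infinite word that is the limit of the $s_k$, and let $$\Omega=\{\omega\in\{a,b\}^{\mathbb Z}:\text{ every finite subword of }\omega\text{ occurs in }u\}.$$ For $\omega\in\Omega$ put $\alpha_{\omega,2n}=\sin\theta_{\omega_n}$ and $\alpha_{\omega,2n+1}=0$ ($n\in\mathbb Z$), and let $\mathcal E_\omega$ be the extended CMV matrix with Verblunsky coefficients $(\alpha_{\omega,n})_{n\in\mathbb Z}$, acting on $\ell^2(\mathbb Z)$: with $\rho_n=(1-|\alpha_n|^2)^{1/2}$, its nonzero entries are, in the rows $2n$ and $2n+1$ and the columns $2n-1,\,2n,\,2n+1,\,2n+2$, $$\begin{pmatrix}\bar\alpha_{2n}\rho_{2n-1}&-\bar\alpha_{2n}\alpha_{2n-1}&\bar\alpha_{2n+1}\rho_{2n}&\rho_{2n+1}\rho_{2n}\\ \rho_{2n}\rho_{2n-1}&-\rho_{2n}\alpha_{2n-1}&-\bar\alpha_{2n+1}\alpha_{2n}&-\rho_{2n+1}\alpha_{2n}\end{pmatrix}.$$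 (This is the matrix of the quantum walk on $\mathbb Z$ whose coin at site $n$ is the rotation by $\theta_{\omega_n}$.) The spectrum of $\mathcal E_\omega$ does not depend on $\omega\in\Omega$; denote it by $\Sigma=\bigcup_{\omega\in\Omega}\sigma(\mathcal E_\omega)$. For $z\in\mathbb C$ and $|\alpha|<1$ let $$T(z,\alpha)=(1-|\alpha|^2)^{-1/2}\begin{pmatrix}z&-\bar\alpha\\-\alpha z&1\end{pmatrix},\qquad T(z,\alpha_1\cdots\alpha_\ell)=T(z,\alpha_\ell)\cdots T(z,\alpha_1),$$ and $T_n(z;\omega)=T(z,\alpha_{\omega,0}\cdots\alpha_{\omega,n-1})$ for $n\ge 0$. Let $\tilde s_k$ be the word obtained from $s_k$ by replacing each letter $l\in\{a,b\}$ by the two coefficients $\sin\theta_l,\,0$, and let $x_k(z)=\frac12\operatorname{Tr}T(z,\tilde s_k)$ for $k\ge 0$. Write $A=T(z,\sin\theta_a)$, $B=T(z,\sin\theta_b)$, $T=T(z,0)$, let $\|\cdot\|$ be the operator norm induced by the Euclidean norm on $\mathbb C^2$, and set $$m(z)=\max\bigl(1,\sup_{k\ge 0}|x_k(z)|\bigr),$$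 $$K(z)=\max\bigl(8\,m(z),\;4\|TA\|,\;4\|TBTA\|,\;4\|TATBTA\|\bigr)\cdot\bigl(4+4\,m(z)\bigr),\qquad \gamma_2(z)=4\log_2K(z).$$ For $\xi:\mathbb Z_{\ge0}\to\mathbb C$ and real $L\ge1$ let $$\|\xi\|_L^2=\sum_{n=0}^{\lfloor L\rfloor}|\xi_n|^2+(L-\lfloor L\rfloor)\,|\xi_{\lfloor L\rfloor+1}|^2 .$$ **Proposition.** Let $z\in\Sigma$. Then $\sup_{k\ge0}|x_k(z)|<\infty$, so that $K(z)$ and $\gamma_2(z)$ are well defined, and there is a constant $C_2(z)>0$ (which may depend on $z,\theta_a,\theta_b$, but not on $\omega$, $\xi$ or $L$) such that for every $\omega\in\Omega$ and all sequences $\xi,\zeta:\mathbb Z_{\ge0}\to\mathbb C$ with $$\begin{pmatrix}\xi_n\\\zeta_n\end{pmatrix}=T_n(z;\omega)\begin{pmatrix}\xi_0\\\zeta_0\end{pmatrix}\ (n\ge0),\qquad |\xi_0|=|\zeta_0|=1,$$ one has $$\|\xi\|_L\le C_2(z)\,L^{2\gamma_2(z)+1}\qquad\text{for all real }L\ge1.$$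 -/

import Mathlib

noncomputable section

namespace FibCMV

/-! ### The Fibonacci subshift -/

/-- The two-letter alphabet `{a, b}`. -/
inductive Letter where
  | a : Letter
  | b : Letter

/-- The Fibonacci substitution on letters: `a ↦ ab`, `b ↦ a`. -/
def substLetter : Letter → List Letter
  | .a => [.a, .b]
  | .b => [.a]

/-- The Fibonacci substitution `S`, extended to finite words by concatenation. -/
def subst (w : List Letter) : List Letter := w.flatMap substLetter

/-- The words `s_k = S^k(a)`: `a`, `ab`, `aba`, `abaab`, and so on. -/
def fibWord (k : ℕ) : List Letter := subst^[k] [.a]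

theorem length_le_length_subst (w : List Letter) : w.length ≤ (subst w).length := by
  induction w with
  | nil => simp [subst]
  | cons l w ih =>
    simp only [subst, List.flatMap_cons, List.length_cons, List.length_append] at ih ⊢
    cases l <;> simp only [substLetter, List.length_cons, List.length_nil] <;> omega

theorem fibWord_succ (k : ℕ) : fibWord (k + 1) = subst (fibWord k) := by
  simp [fibWord, Function.iterate_succ_apply']

/-- Every `s_k` starts with `a`, and `s_k` has more than `k` letters. -/
theorem fibWord_spec (k : ℕ) : ∃ w, fibWord k = Letter.a :: w ∧ k < (fibWord k).length := by
  induction k with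
  | zero => exact ⟨[], rfl, by simp [fibWord]⟩
  | succ k ih =>
    obtain ⟨w, hw, hlen⟩ := ih
    refine ⟨Letter.b :: subst w, ?_, ?_⟩
    · rw [fibWord_succ, hw]; rfl
    · have h := length_le_length_subst w
      rw [fibWord_succ, hw]
      rw [hw, List.length_cons] at hlen
      change k + 1 < (Letter.a :: Letter.b :: subst w).length
      simp only [List.length_cons]
      omega

theorem lt_length_fibWord (k : ℕ) : k < (fibWord k).length := by
  obtain ⟨_, _, h⟩ := fibWord_spec k
  exact h

/-- The one-sided infinite Fibonacci word `u = abaababaabaab…`, the limit of the words `s_k`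
(each of which is a prefix of the next one). -/
def fibU (n : ℕ) : Letter := (fibWord n)[n]'(lt_length_fibWord n)

/-- The Fibonacci subshift `Ω`: the two-sided sequences all of whose finite subwords
occur in `u`. -/
def Omega : Set (ℤ → Letter) :=
  {ω | ∀ (m : ℤ) (l : ℕ), ∃ p : ℕ, ∀ i : ℕ, i < l → ω (m + i) = fibU (p + i)}

/-! ### Extended CMV matrices -/

/-- `ρ = (1 - |α|²)^{1/2}`. -/
def rho (α : ℂ) : ℝ := Real.sqrt (1 - ‖α‖ ^ 2)

/-- The `(m, k)` entry of the extended CMV matrix with Verblunsky coefficients `α`. -/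
def cmvEntry (α : ℤ → ℂ) (m k : ℤ) : ℂ :=
  if Even m then
    if k = m - 1 then star (α m) * rho (α (m - 1))
    else if k = m then -(star (α m) * α (m - 1))
    else if k = m + 1 then star (α (m + 1)) * rho (α m)
    else if k = m + 2 then rho (α (m + 1)) * rho (α m)
    else 0
  else
    if k = m - 2 then rho (α (m - 1)) * rho (α (m - 2))
    else if k = m - 1 then -(rho (α (m - 1)) * α (m - 2))
    else if k = m then -(star (α m) * α (m - 1))
    else if k = m + 1 then -(rho (α m) * α (m - 1))
    else 0

theorem norm_rho_le (α : ℂ) : ‖(rho α : ℂ)‖ ≤ 1 := by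
  rw [Complex.norm_real, Real.norm_eq_abs, rho, abs_of_nonneg (Real.sqrt_nonneg _)]
  exact Real.sqrt_le_one.mpr (by nlinarith [sq_nonneg ‖α‖])

theorem norm_cmvEntry_le (α : ℤ → ℂ) (hα : ∀ n, ‖α n‖ ≤ 1) (m k : ℤ) :
    ‖cmvEntry α m k‖ ≤ 1 := by
  have key : ∀ x y : ℂ, ‖x‖ ≤ 1 → ‖y‖ ≤ 1 → ‖x * y‖ ≤ 1 := fun x y hx hy => by
    rw [norm_mul]; exact mul_le_one₀ hx (norm_nonneg _) hy
  have hs : ∀ n, ‖star (α n)‖ ≤ 1 := fun n => by rw [norm_star]; exact hα n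
  unfold cmvEntry
  split_ifs <;> (try rw [norm_neg]) <;> first
    | (rw [norm_zero]; exact zero_le_one)
    | exact key _ _ (by first | exact hs _ | exact norm_rho_le _)
        (by first | exact hα _ | exact norm_rho_le _)

/-- The Hilbert space `ℓ²(ℤ)`. -/
abbrev ellTwo : Type := lp (fun _ : ℤ => ℂ) 2

theorem weightedShift_aux (c : ℤ → ℂ) (hc : ∀ n, ‖c n‖ ≤ 1) (j : ℤ) (ψ : ellTwo) :
    Summable (fun n => ‖ψ (n + j)‖ ^ 2) ∧ Summable (fun n => ‖c n * ψ (n + j)‖ ^ 2) := by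
  have h1 : Summable (fun n : ℤ => ‖ψ n‖ ^ 2) := by
    have := (lp.memℓp ψ).summable (by norm_num)
    simpa using this
  have h2 : Summable (fun n : ℤ => ‖ψ (n + j)‖ ^ 2) :=
    h1.comp_injective (add_left_injective j)
  refine ⟨h2, Summable.of_nonneg_of_le (fun n => by positivity) (fun n => ?_) h2⟩
  rw [norm_mul, mul_pow]
  exact mul_le_of_le_one_left (by positivity) (pow_le_one₀ (norm_nonneg _) (hc n))

/-- The weighted shift `(W ψ)_n = c_n ψ_{n+j}` on `ℓ²(ℤ)`, for weights bounded by one. -/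
def weightedShift (c : ℤ → ℂ) (hc : ∀ n, ‖c n‖ ≤ 1) (j : ℤ) : ellTwo →L[ℂ] ellTwo :=
  LinearMap.mkContinuous
    { toFun := fun ψ => ⟨fun n => c n * ψ (n + j), memℓp_gen (by
        simpa using (weightedShift_aux c hc j ψ).2)⟩
      map_add' := fun ψ φ => by
        ext n; exact mul_add (c n) (ψ (n + j)) (φ (n + j))
      map_smul' := fun r ψ => by
        ext n; simp [mul_left_comm] }
    1 (fun ψ => by
      rw [one_mul]
      refine lp.norm_le_of_tsum_le (by norm_num) (norm_nonneg _) ?_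
      have h := weightedShift_aux c hc j ψ
      have e : ‖ψ‖ ^ (2 : ENNReal).toReal = ∑' n, ‖ψ (n + j)‖ ^ 2 := by
        rw [lp.norm_rpow_eq_tsum (by norm_num)]
        rw [← (Equiv.addRight j).tsum_eq]
        simp
      rw [e]
      simp only [ENNReal.toReal_ofNat, Real.rpow_ofNat]
      refine h.2.tsum_le_tsum (fun n => ?_) h.1
      change ‖c n * ψ (n + j)‖ ^ 2 ≤ _
      rw [norm_mul, mul_pow]
      exact mul_le_of_le_one_left (by positivity) (pow_le_one₀ (norm_nonneg _) (hc n)))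

@[simp] theorem weightedShift_apply (c : ℤ → ℂ) (hc : ∀ n, ‖c n‖ ≤ 1) (j : ℤ) (ψ : ellTwo)
    (n : ℤ) : weightedShift c hc j ψ n = c n * ψ (n + j) := rfl

/-- The extended CMV matrix with Verblunsky coefficients `α`, as a bounded operator on `ℓ²(ℤ)`:
the sum of its five diagonals. (Genuine CMV matrices have `|α_n| < 1`; boundedness of the
operator only uses `|α_n| ≤ 1`.) -/
def extendedCMV (α : ℤ → ℂ) (hα : ∀ n, ‖α n‖ ≤ 1) : ellTwo →L[ℂ] ellTwo :=
  ∑ j ∈ Finset.Icc (-2 : ℤ) 2,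
    weightedShift (fun n => cmvEntry α n (n + j)) (fun n => norm_cmvEntry_le α hα n (n + j)) j

theorem extendedCMV_apply (α : ℤ → ℂ) (hα : ∀ n, ‖α n‖ ≤ 1) (ψ : ellTwo) (n : ℤ) :
    extendedCMV α hα ψ n = ∑ j ∈ Finset.Icc (-2 : ℤ) 2, cmvEntry α n (n + j) * ψ (n + j) := by
  simp only [extendedCMV, _root_.sum_apply, lp.coeFn_sum, Finset.sum_apply,
    weightedShift_apply]

/-- The matrix of `extendedCMV α` in the standard basis of `ℓ²(ℤ)` is `cmvEntry α`. -/
theorem extendedCMV_single (α : ℤ → ℂ) (hα : ∀ n, ‖α n‖ ≤ 1) (m k : ℤ) :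
    extendedCMV α hα (lp.single 2 k (1 : ℂ)) m = cmvEntry α m k := by
  rw [extendedCMV_apply]
  simp only [lp.coeFn_single, Pi.single_apply, mul_ite, mul_one, mul_zero]
  by_cases h : k - m ∈ Finset.Icc (-2 : ℤ) 2
  · rw [Finset.sum_eq_single_of_mem (k - m) h]
    · simp
    · intro j _ hj
      rw [if_neg (by omega)]
  · have h0 : cmvEntry α m k = 0 := by
      rw [Finset.mem_Icc] at h
      unfold cmvEntry
      split_ifs <;> first | rfl | omega
    rw [h0]
    refine Finset.sum_eq_zero fun j hj => ?_
    rw [if_neg]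
    rintro e
    exact h (by rw [← e]; simpa using hj)

/-! ### The Fibonacci quantum walk -/

/-- The rotation angle of the coin attached to a letter. -/
def angle (θa θb : ℝ) : Letter → ℝ
  | .a => θa
  | .b => θb

/-- The Verblunsky coefficients of the quantum walk with coins
`C_{ω_n} = !![cos θ, -sin θ; sin θ, cos θ]`, `θ = θ_{ω_n}`:
`α_{2n} = sin θ_{ω_n}` and `α_{2n+1} = 0`. -/
def verblunsky (θa θb : ℝ) (ω : ℤ → Letter) (m : ℤ) : ℂ :=
  if Even m then ((Real.sin (angle θa θb (ω (m / 2))) : ℝ) : ℂ) else 0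

theorem norm_verblunsky_le (θa θb : ℝ) (ω : ℤ → Letter) (m : ℤ) :
    ‖verblunsky θa θb ω m‖ ≤ 1 := by
  unfold verblunsky
  split_ifs
  · rw [Complex.norm_real]; exact Real.abs_sin_le_one _
  · simp

/-- The operator `ℰ_ω = U_ω`. -/
def walkOperator (θa θb : ℝ) (ω : ℤ → Letter) : ellTwo →L[ℂ] ellTwo :=
  extendedCMV (verblunsky θa θb ω) (norm_verblunsky_le θa θb ω)

/-- The set `Σ`. The spectrum of `ℰ_ω` is the same for all `ω ∈ Ω`, so that the union
below is the spectrum of any single `ℰ_ω`, `ω ∈ Ω`. -/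
def walkSpectrum (θa θb : ℝ) : Set ℂ := ⋃ ω ∈ Omega, spectrum ℂ (walkOperator θa θb ω)

/-! ### Transfer matrices -/

/-- The transfer matrix `T(z, α)`. -/
def transfer (z α : ℂ) : Matrix (Fin 2) (Fin 2) ℂ :=
  ((rho α : ℝ) : ℂ)⁻¹ • !![z, -star α; -(α * z), 1]

/-- `T(z, α₁ ⋯ α_ℓ) = T(z, α_ℓ) ⋯ T(z, α₁)`. -/
def transferWord (z : ℂ) : List ℂ → Matrix (Fin 2) (Fin 2) ℂ
  | [] => 1
  | α :: w => transferWord z w * transfer z α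

/-- `T_n(z; ω) = T(z, α_{ω,0} ⋯ α_{ω,n-1})`. -/
def transferN (θa θb : ℝ) (z : ℂ) (ω : ℤ → Letter) (n : ℕ) : Matrix (Fin 2) (Fin 2) ℂ :=
  transferWord z ((List.range n).map fun i => verblunsky θa θb ω (i : ℤ))

/-- `s_k` with each letter replaced by its sine followed by a zero coefficient. -/
def blockWord (θa θb : ℝ) (k : ℕ) : List ℂ :=
  (fibWord k).flatMap fun l => [((Real.sin (angle θa θb l) : ℝ) : ℂ), 0]

/-- The half-trace `x_k(z)` of `M_k(z) = T(z, s̃_k)`, `s̃_k = blockWord k`. -/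
def halfTrace (θa θb : ℝ) (z : ℂ) (k : ℕ) : ℂ :=
  (1 / 2 : ℂ) * (transferWord z (blockWord θa θb k)).trace

/-- The operator norm on `2 × 2` matrices induced by the Euclidean norm on `ℂ²`. -/
def opNorm (M : Matrix (Fin 2) (Fin 2) ℂ) : ℝ := ‖Matrix.toEuclideanCLM (𝕜 := ℂ) M‖

/-- `max(1, sup_k |x_k(z)|)`. -/
def traceBound (θa θb : ℝ) (z : ℂ) : ℝ := max 1 (⨆ k : ℕ, ‖halfTrace θa θb z k‖)

/-- The constant `K(z)`, with `A = T(z, sin θ_a)`, `B = T(z, sin θ_b)`, `T = T(z, 0)`. -/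
def constK (θa θb : ℝ) (z : ℂ) : ℝ :=
  let A := transfer z ((Real.sin θa : ℝ) : ℂ)
  let B := transfer z ((Real.sin θb : ℝ) : ℂ)
  let T := transfer z 0
  max (max (max (8 * traceBound θa θb z) (4 * opNorm (T * A))) (4 * opNorm (T * B * T * A)))
      (4 * opNorm (T * A * T * B * T * A))
    * (4 + 4 * traceBound θa θb z)

/-- The exponent `γ₂(z) = 4 log₂ K(z)`. -/
def gammaTwo (θa θb : ℝ) (z : ℂ) : ℝ := 4 * Real.logb 2 (constK θa θb z)

/-- The local norm `‖ξ‖_L`, `L ≥ 1` real. -/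
def localNorm (ξ : ℕ → ℂ) (L : ℝ) : ℝ :=
  Real.sqrt (∑ n ∈ Finset.range (⌊L⌋₊ + 1), ‖ξ n‖ ^ 2 + (L - ⌊L⌋₊) * ‖ξ (⌊L⌋₊ + 1)‖ ^ 2)

end FibCMV

end

/-!
Write `N_l = z⁻¹ T(z, 0) T(z, sin θ_l)` (`walkMat`) for the transfer matrix over one site carrying
the letter `l`, normalized to determinant one, and let `N_k` (`fibMat`) be the product along `s_k`.
Then `N_{k+2} = N_k N_{k+1}`, and for `|z| = 1` the trace of `N_k` has modulus `2 |x_k(z)|`.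
The walk operator is unitary, so that `|z| = 1` on the spectrum.

*Boundedness of the traces.* Let `|z| = 1` and suppose that the traces `t_k` of `N_k` are unbounded.
By the trace map `t_{k+3} = t_{k+2} t_{k+1} - t_k` and its invariant, for every `R` there are three
consecutive traces of modulus larger than `R` (`exists_three_large`). On the other hand, for each
`k`, at every site of every `ω ∈ Ω` the gap before this site or the next one is the centre of a
square `v v` in which `v` is a rotation of `s_k`, `s_{k+1}` or `s_{k+2}` (`exists_square`); this
property is checked for `k = 0` and propagates along the substitution. By Cayley–Hamilton, a
solution at the centre of such a square is smaller than the sum of its values at the two ends by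
the factor `|t_j|⁻¹` (`norm_le_of_square`). Summing the squares over all sites, one finds
`‖ψ‖ ≤ ½ ‖ψ‖ + C ‖(ℰ_ω - z) ψ‖` once `R` is large. Hence `ℰ_ω - z` is bounded below and, `ℰ_ω` being
normal, `z` is not in the spectrum (`notMem_spectrum_of_traces_large`).

*Growth of solutions.* Suppose that `|x_k(z)| ≤ m` for all `k`, and put `Y = N_k`, `X = N_{k+1}`.
By Cayley–Hamilton the span of `1, Y, X, Y X` is stable under left multiplication by `X` and right
multiplication by `Y`, and contains the corresponding span of level `k + 1`; each of these
operations enlarges the coefficients by a factor at most `(2 m + 1)²`. A factor of a Fibonacci word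
is the image under `S` of another factor, up to an additional letter `b` on the left and `a` on the
right, and two such desubstitutions halve its length (`IsFactor.isComb`). So the transfer matrix
over `n` sites grows by at most `(2 m + 1)¹²` when `n` doubles, uniformly in `ω`. As
`(2 m + 1)² ≤ K(z)` (`sq_le_constK`), this is at most the power `L ^ (2 γ₂)`, and summation over
`n ≤ L + 1` costs at most one further factor `L`.
-/

open Matrix
open scoped Matrix.Norms.Operator

noncomputable section

namespace FibCMV

/-! ### Products of unimodular matrices along Fibonacci words -/

/-- The product of the matrices `A l` along a word, later letters acting from the left. -/
def wordMat (A : Letter → Matrix (Fin 2) (Fin 2) ℂ) : List Letter → Matrix (Fin 2) (Fin 2) ℂ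
  | [] => 1
  | l :: w => wordMat A w * A l

section WordMat

variable (A : Letter → Matrix (Fin 2) (Fin 2) ℂ)

@[simp] theorem wordMat_nil : wordMat A [] = 1 := rfl

@[simp] theorem wordMat_cons (l : Letter) (w : List Letter) :
    wordMat A (l :: w) = wordMat A w * A l := rfl

theorem wordMat_append (v w : List Letter) :
    wordMat A (v ++ w) = wordMat A w * wordMat A v := by
  induction v with
  | nil => simp
  | cons l v ih => simp [ih, mul_assoc]

theorem det_wordMat (hA : ∀ l, (A l).det = 1) (w : List Letter) : (wordMat A w).det = 1 := by
  induction w with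
  | nil => simp
  | cons l w ih => simp [ih, hA]

theorem trace_wordMat_of_isRotated {v w : List Letter} (h : v ~r w) :
    (wordMat A v).trace = (wordMat A w).trace := by
  obtain ⟨n, rfl⟩ := h
  induction n generalizing v with
  | zero => simp
  | succ n ih =>
    cases v with
    | nil => simp
    | cons l v =>
      rw [List.rotate_cons_succ, ← ih, wordMat_append]
      simpa using trace_mul_comm _ _

/-- The matrix of the word `s_k`. -/
def fibMat (k : ℕ) : Matrix (Fin 2) (Fin 2) ℂ := wordMat A (fibWord k)

/-- The letters read at level `k` of the hierarchy: `a` stands for `s_{k+1}`, `b` for `s_k`. -/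
def levelMat (k : ℕ) : Letter → Matrix (Fin 2) (Fin 2) ℂ
  | .a => fibMat A (k + 1)
  | .b => fibMat A k

end WordMat

@[simp] theorem subst_nil : subst [] = [] := rfl

theorem subst_cons (l : Letter) (w : List Letter) : subst (l :: w) = substLetter l ++ subst w := by
  simp [subst]

theorem subst_append (v w : List Letter) : subst (v ++ w) = subst v ++ subst w := by
  simp [subst]

theorem fibWord_add_two (k : ℕ) : fibWord (k + 2) = fibWord (k + 1) ++ fibWord k := by
  induction k with
  | zero => rfl
  | succ k ih => rw [fibWord_succ (k + 2), ih, subst_append, ← fibWord_succ, ← fibWord_succ, ← ih]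

section TwoByTwo

variable (X Y : Matrix (Fin 2) (Fin 2) ℂ)

theorem mul_self_eq_trace_smul (hX : X.det = 1) : X * X = X.trace • X - 1 := by
  rw [det_fin_two] at hX
  ext i j
  fin_cases i <;> fin_cases j <;>
    simp [Matrix.mul_apply, trace_fin_two] <;>
    first | ring1 | linear_combination (-1 : ℂ) * hX

theorem mul_eq_neg_mul_swap_add :
    X * Y = -(Y * X) + X.trace • Y + Y.trace • X
      + ((Y * X).trace - X.trace * Y.trace) • (1 : Matrix (Fin 2) (Fin 2) ℂ) := by
  ext i j
  fin_cases i <;> fin_cases j <;>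
    simp [Matrix.mul_apply, trace_fin_two] <;> ring

theorem mul_mul_self_swap (hX : X.det = 1) :
    X * (Y * X) = (Y * X).trace • X - Y.trace • (1 : Matrix (Fin 2) (Fin 2) ℂ) + Y := by
  rw [det_fin_two] at hX
  ext i j
  fin_cases i <;> fin_cases j <;>
    simp [Matrix.mul_apply, trace_fin_two]
  · linear_combination (-Y 1 1) * hX
  · linear_combination (Y 0 1) * hX
  · linear_combination (Y 1 0) * hX
  · linear_combination (-Y 0 0) * hX

end TwoByTwo

section Trace

variable {A : Letter → Matrix (Fin 2) (Fin 2) ℂ}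

theorem fibMat_add_two (k : ℕ) : fibMat A (k + 2) = fibMat A k * fibMat A (k + 1) := by
  rw [fibMat, fibWord_add_two, wordMat_append]; rfl

theorem det_fibMat (hA : ∀ l, (A l).det = 1) (k : ℕ) : (fibMat A k).det = 1 :=
  det_wordMat A hA _

/-- The trace map of the Fibonacci substitution. -/
theorem trace_fibMat_add_three (hA : ∀ l, (A l).det = 1) (k : ℕ) :
    (fibMat A (k + 3)).trace =
      (fibMat A (k + 2)).trace * (fibMat A (k + 1)).trace - (fibMat A k).trace := by
  rw [fibMat_add_two (k + 1), show k + 1 + 1 = k + 2 from rfl, fibMat_add_two k,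
    mul_mul_self_swap _ _ (det_fibMat hA _)]
  simp
  ring

theorem wordMat_levelMat_subst (k : ℕ) (w : List Letter) :
    wordMat (levelMat A k) (subst w) = wordMat (levelMat A (k + 1)) w := by
  induction w with
  | nil => rfl
  | cons l w ih =>
    rw [subst_cons, wordMat_append, ih, wordMat_cons]
    cases l
    · simp [substLetter, levelMat, fibMat_add_two k]
    · simp [substLetter, levelMat]

theorem wordMat_subst (w : List Letter) :
    wordMat A (subst w) = wordMat (levelMat A 0) w := by
  induction w with
  | nil => rfl
  | cons l w ih =>
    rw [subst_cons, wordMat_append, ih, wordMat_cons]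
    cases l <;> simp [substLetter, levelMat, fibMat, fibWord, subst]

end Trace

/-- A solution of the Fibonacci trace map that is unbounded has three consecutive terms beyond any
given bound. Two neighbours `t k`, `t (k + 2)` of bounded size confine `t (k + 1)`, because
`x² + y² + w² - x y w` is invariant; hence two consecutive large terms occur, and the first such
pair forces the next term to be large. -/
theorem exists_three_large (t : ℕ → ℂ) (ht : ∀ k, t (k + 3) = t (k + 2) * t (k + 1) - t k)
    (hunb : ¬ BddAbove (Set.range fun k => ‖t k‖)) (R : ℝ) :
    ∃ k, R < ‖t k‖ ∧ R < ‖t (k + 1)‖ ∧ R < ‖t (k + 2)‖ := by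
  classical
  have hinv : ∀ k, t k ^ 2 + t (k + 1) ^ 2 + t (k + 2) ^ 2 - t k * t (k + 1) * t (k + 2)
      = t 0 ^ 2 + t 1 ^ 2 + t 2 ^ 2 - t 0 * t 1 * t 2 := by
    intro k
    induction k with
    | zero => rfl
    | succ k ih =>
      rw [← ih, show k + 1 + 2 = k + 3 from rfl, show k + 1 + 1 = k + 2 from rfl, ht]
      ring
  set J := t 0 ^ 2 + t 1 ^ 2 + t 2 ^ 2 - t 0 * t 1 * t 2
  set S : ℝ := max R (max 2 ‖t 0‖)
  have hRS : R ≤ S := le_max_left _ _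
  have h2S : 2 ≤ S := (le_max_left _ _).trans (le_max_right _ _)
  have h0S : ‖t 0‖ ≤ S := (le_max_right _ _).trans (le_max_right _ _)
  have hex : ∃ k, S < ‖t k‖ ∧ S < ‖t (k + 1)‖ := by
    by_contra! hno
    refine hunb ⟨3 * S ^ 2 + ‖J‖ + S, ?_⟩
    rintro _ ⟨k, rfl⟩
    dsimp only
    rcases k with _ | k
    · nlinarith [norm_nonneg J]
    by_contra! hbig
    have hk1 : S < ‖t (k + 1)‖ := by nlinarith [norm_nonneg J]
    have hk2 : ‖t (k + 2)‖ ≤ S := hno (k + 1) hk1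
    have hk0 : ‖t k‖ ≤ S := by
      by_contra! h
      exact absurd (hno k h) (not_le.mpr hk1)
    have e : t (k + 1) ^ 2 = t k * t (k + 2) * t (k + 1) + J - t k ^ 2 - t (k + 2) ^ 2 := by
      linear_combination hinv k
    have hn : ‖t (k + 1)‖ ^ 2 ≤ S * S * ‖t (k + 1)‖ + ‖J‖ + S ^ 2 + S ^ 2 := by
      rw [← norm_pow, e]
      refine (norm_sub_le _ _).trans (add_le_add ((norm_sub_le _ _).trans (add_le_add
        ((norm_add_le _ _).trans (add_le_add ?_ le_rfl)) ?_)) ?_)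
      · rw [norm_mul, norm_mul]
        gcongr
      · rw [norm_pow]; gcongr
      · rw [norm_pow]; gcongr
    nlinarith [norm_nonneg J, norm_nonneg (t (k + 1))]
  have hk := Nat.find_spec hex
  have hmin := fun j => Nat.find_min hex (m := j)
  generalize Nat.find hex = k at hk hmin
  rcases k with _ | k
  · exact absurd hk.1 (not_lt.mpr h0S)
  have hk0 : ‖t k‖ ≤ S := by
    by_contra! h
    exact hmin k (Nat.lt_succ_self k) ⟨h, hk.1⟩
  refine ⟨k + 1, hRS.trans_lt hk.1, hRS.trans_lt hk.2, hRS.trans_lt ?_⟩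
  have h3 : ‖t (k + 2)‖ * ‖t (k + 1)‖ ≤ ‖t (k + 3)‖ + ‖t k‖ := by
    rw [← norm_mul]
    have : t (k + 2) * t (k + 1) = t (k + 3) + t k := by rw [ht]; ring
    rw [this]
    exact norm_add_le _ _
  have h4 : S < ‖t (k + 2)‖ := hk.2
  have h5 : S < ‖t (k + 1)‖ := hk.1
  change S < ‖t (k + 3)‖
  nlinarith

/-! ### Factors of Fibonacci words -/

/-- A prefix of `S(v)` is the image of a prefix of `v`, possibly followed by the first letter of a
block `ab`. -/
theorem prefix_subst {w v : List Letter} (h : w <+: subst v) :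
    ∃ v', v' <+: v ∧ (w = subst v' ∨ w = subst v' ++ [.a]) := by
  induction v generalizing w with
  | nil => exact ⟨[], List.prefix_rfl, .inl (by simpa using h)⟩
  | cons l v ih =>
    rw [subst_cons] at h
    rcases w with _ | ⟨x, w⟩
    · exact ⟨[], List.nil_prefix, .inl rfl⟩
    cases l
    · simp only [substLetter, List.cons_append, List.nil_append, List.cons_prefix_cons] at h
      obtain ⟨rfl, h⟩ := h
      rcases w with _ | ⟨y, w⟩
      · exact ⟨[], List.nil_prefix, .inr rfl⟩
      obtain ⟨rfl, h'⟩ := List.cons_prefix_cons.1 h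
      obtain ⟨v', hv, hw⟩ := ih h'
      refine ⟨.a :: v', List.cons_prefix_cons.2 ⟨rfl, hv⟩, ?_⟩
      rw [subst_cons]
      exact hw.imp (fun e => by simp [substLetter, e]) (fun e => by simp [substLetter, e])
    · simp only [substLetter, List.cons_append, List.nil_append, List.cons_prefix_cons] at h
      obtain ⟨rfl, h⟩ := h
      obtain ⟨v', hv, hw⟩ := ih h
      refine ⟨.b :: v', List.cons_prefix_cons.2 ⟨rfl, hv⟩, ?_⟩
      rw [subst_cons]
      exact hw.imp (fun e => by simp [substLetter, e]) (fun e => by simp [substLetter, e])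

/-- A suffix of `S(v)` is the image of a suffix of `v`, possibly preceded by the last letter of a
block `ab`. -/
theorem suffix_subst {w v : List Letter} (h : w <:+ subst v) :
    ∃ v', v' <:+ v ∧ (w = subst v' ∨ w = .b :: subst v') := by
  induction v with
  | nil => exact ⟨[], List.suffix_rfl, .inl (by simpa using h)⟩
  | cons l v ih =>
    rw [subst_cons] at h
    cases l
    · simp only [substLetter, List.cons_append, List.nil_append] at h
      rcases List.suffix_cons_iff.1 h with rfl | h
      · exact ⟨.a :: v, List.suffix_rfl, .inl (by simp [subst_cons, substLetter])⟩
      rcases List.suffix_cons_iff.1 h with rfl | h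
      · exact ⟨v, List.suffix_cons _ _, .inr rfl⟩
      obtain ⟨v', hv, hw⟩ := ih h
      exact ⟨v', hv.trans (List.suffix_cons _ _), hw⟩
    · simp only [substLetter, List.cons_append, List.nil_append] at h
      rcases List.suffix_cons_iff.1 h with rfl | h
      · exact ⟨.b :: v, List.suffix_rfl, .inl (by simp [subst_cons, substLetter])⟩
      obtain ⟨v', hv, hw⟩ := ih h
      exact ⟨v', hv.trans (List.suffix_cons _ _), hw⟩

/-- A factor of `S(v)` is `S` of a factor of `v`, up to a cut block on either side. -/
theorem infix_subst {w v : List Letter} (h : w <:+: subst v) :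
    ∃ p v' s, v' <:+: v ∧ (p = [] ∨ p = [.b]) ∧ (s = [] ∨ s = [.a]) ∧
      w = p ++ subst v' ++ s := by
  obtain ⟨t, hwt, ht⟩ := List.infix_iff_prefix_suffix.1 h
  obtain ⟨v₁, hv₁, rfl | rfl⟩ := suffix_subst ht
  · obtain ⟨v₂, hv₂, e⟩ := prefix_subst hwt
    have hi : v₂ <:+: v := hv₂.isInfix.trans hv₁.isInfix
    rcases e with e | e
    · exact ⟨[], v₂, [], hi, .inl rfl, .inl rfl, by simp [e]⟩
    · exact ⟨[], v₂, [.a], hi, .inl rfl, .inr rfl, by simp [e]⟩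
  · rcases w with _ | ⟨x, w⟩
    · exact ⟨[], [], [], List.nil_infix, .inl rfl, .inl rfl, rfl⟩
    obtain ⟨rfl, hw⟩ := List.cons_prefix_cons.1 hwt
    obtain ⟨v₂, hv₂, e⟩ := prefix_subst hw
    have hi : v₂ <:+: v := hv₂.isInfix.trans hv₁.isInfix
    rcases e with e | e
    · exact ⟨[.b], v₂, [], hi, .inr rfl, .inl rfl, by simp [e]⟩
    · exact ⟨[.b], v₂, [.a], hi, .inr rfl, .inr rfl, by simp [e]⟩

theorem fibWord_prefix_succ (k : ℕ) : fibWord k <+: fibWord (k + 1) := by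
  cases k with
  | zero => exact ⟨[.b], rfl⟩
  | succ k => exact ⟨fibWord k, (fibWord_add_two k).symm⟩

theorem fibWord_prefix_of_le {j k : ℕ} (h : j ≤ k) : fibWord j <+: fibWord k := by
  induction k, h using Nat.le_induction with
  | base => exact List.prefix_rfl
  | succ k _ ih => exact ih.trans (fibWord_prefix_succ k)

/-- The factors of the Fibonacci words. -/
def IsFactor (w : List Letter) : Prop := ∃ k, w <:+: fibWord k

theorem IsFactor.desubst {w : List Letter} (h : IsFactor w) :
    ∃ p v s, IsFactor v ∧ (p = [] ∨ p = [.b]) ∧ (s = [] ∨ s = [.a]) ∧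
      w = p ++ subst v ++ s := by
  obtain ⟨k, hk⟩ := h
  obtain ⟨p, v, s, hv, h⟩ :=
    infix_subst (v := fibWord k) (fibWord_succ k ▸ hk.trans (fibWord_prefix_succ k).isInfix)
  exact ⟨p, v, s, ⟨k, hv⟩, h⟩

theorem two_mul_length_le_length_subst_subst (w : List Letter) :
    2 * w.length ≤ (subst (subst w)).length := by
  induction w with
  | nil => simp
  | cons l w ih =>
    cases l <;> simp [subst_cons, substLetter] <;> omega

/-! ### Factors as combinations of four matrices -/

/-- `P` is a combination of `1, Y, X, Y X`, where `Y` and `X` are the matrices of `s_k` and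
`s_{k+1}`, with coefficients bounded by `R`. -/
def IsComb (A : Letter → Matrix (Fin 2) (Fin 2) ℂ) (k : ℕ) (R : ℝ)
    (P : Matrix (Fin 2) (Fin 2) ℂ) : Prop :=
  ∃ c₀ c₁ c₂ c₃ : ℂ, ‖c₀‖ ≤ R ∧ ‖c₁‖ ≤ R ∧ ‖c₂‖ ≤ R ∧ ‖c₃‖ ≤ R ∧
    P = c₀ • (1 : Matrix (Fin 2) (Fin 2) ℂ) + c₁ • fibMat A k + c₂ • fibMat A (k + 1)
      + c₃ • (fibMat A k * fibMat A (k + 1))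

section Comb

variable {A : Letter → Matrix (Fin 2) (Fin 2) ℂ} {m R : ℝ} {k : ℕ}
  {P : Matrix (Fin 2) (Fin 2) ℂ}

theorem IsComb.mono {R' : ℝ} (h : IsComb A k R P) (hR : R ≤ R') : IsComb A k R' P := by
  obtain ⟨c₀, c₁, c₂, c₃, h₀, h₁, h₂, h₃, e⟩ := h
  exact ⟨c₀, c₁, c₂, c₃, h₀.trans hR, h₁.trans hR, h₂.trans hR, h₃.trans hR, e⟩

theorem isComb_one : IsComb A k 1 1 := ⟨1, 0, 0, 0, by simp⟩

theorem IsComb.nonneg (h : IsComb A k R P) : 0 ≤ R := by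
  obtain ⟨c₀, _, _, _, h₀, _⟩ := h
  exact (norm_nonneg _).trans h₀

variable (hA : ∀ l, (A l).det = 1) (hm : 1 ≤ m) (ht : ∀ k, ‖(fibMat A k).trace‖ ≤ 2 * m)
include hA hm ht

/-- Passing to the next lower level: `Y' = X`, `X' = Y X`, and `Y' X' = X Y X` is a combination of
`X`, `Y` and `1` by the Cayley–Hamilton theorem. -/
theorem IsComb.of_succ (h : IsComb A (k + 1) R P) : IsComb A k ((2 * m + 1) ^ 2 * R) P := by
  have hR := h.nonneg
  obtain ⟨c₀, c₁, c₂, c₃, h₀, h₁, h₂, h₃, rfl⟩ := h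
  have e : fibMat A (k + 1 + 1) = fibMat A k * fibMat A (k + 1) := fibMat_add_two k
  have ty := ht k
  have tz := ht (k + 1 + 1)
  rw [e, mul_mul_self_swap _ _ (det_fibMat hA _)]
  rw [e] at tz
  unfold IsComb
  generalize fibMat A k = Y at *
  generalize fibMat A (k + 1) = X at *
  refine ⟨c₀ - c₃ * Y.trace, c₃, c₁ + c₃ * (Y * X).trace, c₂, ?_, ?_, ?_, ?_, ?_⟩
  · calc _ ≤ ‖c₀‖ + ‖c₃‖ * ‖Y.trace‖ := (norm_sub_le _ _).trans_eq (by rw [norm_mul])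
      _ ≤ R + R * (2 * m) := by gcongr
      _ ≤ _ := by nlinarith [mul_nonneg hR (sub_nonneg.2 hm), mul_nonneg hR (sq_nonneg m)]
  · nlinarith [mul_nonneg hR (sub_nonneg.2 hm), mul_nonneg hR (sq_nonneg m)]
  · calc _ ≤ ‖c₁‖ + ‖c₃‖ * ‖(Y * X).trace‖ := (norm_add_le _ _).trans_eq (by rw [norm_mul])
      _ ≤ R + R * (2 * m) := by gcongr
      _ ≤ _ := by nlinarith [mul_nonneg hR (sub_nonneg.2 hm), mul_nonneg hR (sq_nonneg m)]
  · nlinarith [mul_nonneg hR (sub_nonneg.2 hm), mul_nonneg hR (sq_nonneg m)]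
  · module

theorem IsComb.mul_left (h : IsComb A k R P) :
    IsComb A k ((2 * m + 1) ^ 2 * R) (fibMat A (k + 1) * P) := by
  have hR := h.nonneg
  obtain ⟨c₀, c₁, c₂, c₃, h₀, h₁, h₂, h₃, rfl⟩ := h
  have e : fibMat A (k + 2) = fibMat A k * fibMat A (k + 1) := fibMat_add_two k
  have ty := ht k
  have tx := ht (k + 1)
  have tz := ht (k + 2)
  have dx := det_fibMat hA (k + 1)
  rw [e] at tz
  unfold IsComb
  generalize fibMat A k = Y at *
  generalize fibMat A (k + 1) = X at *
  rw [mul_add, mul_add, mul_add, mul_smul_comm, mul_smul_comm, mul_smul_comm, mul_smul_comm,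
    mul_mul_self_swap X Y dx, mul_self_eq_trace_smul X dx, mul_eq_neg_mul_swap_add X Y, mul_one]
  refine ⟨c₁ * ((Y * X).trace - X.trace * Y.trace) - c₂ - c₃ * Y.trace, c₁ * X.trace + c₃,
    c₀ + c₁ * Y.trace + c₂ * X.trace + c₃ * (Y * X).trace, -c₁, ?_, ?_, ?_, ?_, ?_⟩
  · calc _ ≤ ‖c₁‖ * (‖(Y * X).trace‖ + ‖X.trace‖ * ‖Y.trace‖) + ‖c₂‖ + ‖c₃‖ * ‖Y.trace‖ := by
          refine (norm_sub_le _ _).trans (add_le_add ((norm_sub_le _ _).trans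
            (add_le_add ?_ le_rfl)) (norm_mul _ _).le)
          rw [norm_mul]
          gcongr
          exact (norm_sub_le _ _).trans_eq (by rw [norm_mul])
      _ ≤ R * (2 * m + 2 * m * (2 * m)) + R + R * (2 * m) := by gcongr
      _ ≤ _ := by nlinarith
  · calc _ ≤ ‖c₁‖ * ‖X.trace‖ + ‖c₃‖ := (norm_add_le _ _).trans_eq (by rw [norm_mul])
      _ ≤ R * (2 * m) + R := by gcongr
      _ ≤ _ := by nlinarith [mul_nonneg hR (sub_nonneg.2 hm), mul_nonneg hR (sq_nonneg m)]
  · calc _ ≤ ‖c₀‖ + ‖c₁‖ * ‖Y.trace‖ + ‖c₂‖ * ‖X.trace‖ + ‖c₃‖ * ‖(Y * X).trace‖ := by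
          simp only [← norm_mul]
          exact norm_add₄_le
      _ ≤ R + R * (2 * m) + R * (2 * m) + R * (2 * m) := by gcongr
      _ ≤ _ := by nlinarith [mul_nonneg (mul_nonneg hR (sub_nonneg.2 hm)) (by linarith : 0 ≤ m)]
  · rw [norm_neg]
    nlinarith [mul_nonneg hR (sub_nonneg.2 hm), mul_nonneg hR (sq_nonneg m)]
  · module

theorem IsComb.mul_right (h : IsComb A k R P) :
    IsComb A k ((2 * m + 1) ^ 2 * R) (P * fibMat A k) := by
  have hR := h.nonneg
  obtain ⟨c₀, c₁, c₂, c₃, h₀, h₁, h₂, h₃, rfl⟩ := h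
  have e : fibMat A (k + 2) = fibMat A k * fibMat A (k + 1) := fibMat_add_two k
  have ty := ht k
  have tx := ht (k + 1)
  have tz := ht (k + 2)
  have dy := det_fibMat hA k
  rw [e] at tz
  unfold IsComb
  generalize fibMat A k = Y at *
  generalize fibMat A (k + 1) = X at *
  rw [add_mul, add_mul, add_mul, smul_mul_assoc, smul_mul_assoc, smul_mul_assoc, smul_mul_assoc,
    mul_assoc Y X Y, mul_mul_self_swap Y X dy, trace_mul_comm X Y, mul_self_eq_trace_smul Y dy,
    mul_eq_neg_mul_swap_add X Y, one_mul]
  refine ⟨c₂ * ((Y * X).trace - X.trace * Y.trace) - c₁ - c₃ * X.trace,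
    c₀ + c₁ * Y.trace + c₂ * X.trace + c₃ * (Y * X).trace, c₂ * Y.trace + c₃, -c₂,
    ?_, ?_, ?_, ?_, ?_⟩
  · calc _ ≤ ‖c₂‖ * (‖(Y * X).trace‖ + ‖X.trace‖ * ‖Y.trace‖) + ‖c₁‖ + ‖c₃‖ * ‖X.trace‖ := by
          refine (norm_sub_le _ _).trans (add_le_add ((norm_sub_le _ _).trans
            (add_le_add ?_ le_rfl)) (norm_mul _ _).le)
          rw [norm_mul]
          gcongr
          exact (norm_sub_le _ _).trans_eq (by rw [norm_mul])
      _ ≤ R * (2 * m + 2 * m * (2 * m)) + R + R * (2 * m) := by gcongr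
      _ ≤ _ := by nlinarith
  · calc _ ≤ ‖c₀‖ + ‖c₁‖ * ‖Y.trace‖ + ‖c₂‖ * ‖X.trace‖ + ‖c₃‖ * ‖(Y * X).trace‖ := by
          simp only [← norm_mul]
          exact norm_add₄_le
      _ ≤ R + R * (2 * m) + R * (2 * m) + R * (2 * m) := by gcongr
      _ ≤ _ := by nlinarith [mul_nonneg (mul_nonneg hR (sub_nonneg.2 hm)) (by linarith : 0 ≤ m)]
  · calc _ ≤ ‖c₂‖ * ‖Y.trace‖ + ‖c₃‖ := (norm_add_le _ _).trans_eq (by rw [norm_mul])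
      _ ≤ R * (2 * m) + R := by gcongr
      _ ≤ _ := by nlinarith [mul_nonneg hR (sub_nonneg.2 hm), mul_nonneg hR (sq_nonneg m)]
  · rw [norm_neg]
    nlinarith [mul_nonneg hR (sub_nonneg.2 hm), mul_nonneg hR (sq_nonneg m)]
  · module

/-- One desubstitution costs a change of level and at most one multiplication on either side: an
initial letter `b` is applied first, so that it multiplies by `Y` from the right, and a final `a`
multiplies by `X` from the left. -/
theorem isComb_desubst {p v s : List Letter} (hp : p = [] ∨ p = [.b]) (hs : s = [] ∨ s = [.a])
    (h : IsComb A (k + 1) R (wordMat (levelMat A (k + 1)) v)) :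
    IsComb A k (((2 * m + 1) ^ 2) ^ 3 * R) (wordMat (levelMat A k) (p ++ subst v ++ s)) := by
  have hq : 1 ≤ (2 * m + 1) ^ 2 := by nlinarith
  have step : ∀ {r Q}, IsComb A k r Q → IsComb A k ((2 * m + 1) ^ 2 * r) Q := fun h =>
    h.mono (le_mul_of_one_le_left h.nonneg hq)
  rw [wordMat_append, wordMat_append, wordMat_levelMat_subst,
    show ((2 * m + 1) ^ 2) ^ 3 * R
      = (2 * m + 1) ^ 2 * ((2 * m + 1) ^ 2 * ((2 * m + 1) ^ 2 * R)) by ring]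
  replace h := h.of_succ hA hm ht
  have h' : IsComb A k ((2 * m + 1) ^ 2 * ((2 * m + 1) ^ 2 * R))
      (wordMat (levelMat A (k + 1)) v * wordMat (levelMat A k) p) := by
    rcases hp with rfl | rfl
    · simpa using step h
    · simpa [levelMat] using h.mul_right hA hm ht
  rcases hs with rfl | rfl
  · simpa using step h'
  · simpa [levelMat] using h'.mul_left hA hm ht

/-- Two desubstitutions at least halve the length of a factor, so that the coefficients of its
matrix grow at most by a fixed power of `2 m + 1` for each doubling of the length. -/
theorem IsFactor.isComb {w : List Letter} (hw : IsFactor w) (j k : ℕ) (hj : w.length < 2 ^ j) :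
    IsComb A k ((((2 * m + 1) ^ 2) ^ 6) ^ j) (wordMat (levelMat A k) w) := by
  induction j generalizing w k with
  | zero =>
    obtain rfl : w = [] := List.length_eq_zero_iff.1 (by simpa using hj)
    simpa using isComb_one
  | succ j ih =>
    obtain ⟨p, v, s, hv, hp, hs, rfl⟩ := hw.desubst
    obtain ⟨p', v', s', hv', hp', hs', rfl⟩ := hv.desubst
    have hlen := two_mul_length_le_length_subst_subst v'
    have h := ih hv' (k + 2) (by
      simp only [subst_append, List.length_append] at hj
      rw [pow_succ] at hj
      omega)
    have := isComb_desubst hA hm ht hp hs (isComb_desubst hA hm ht hp' hs' h)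
    refine this.mono (le_of_eq ?_)
    rw [pow_succ _ j]
    ring

/-- The letters themselves sit one level below the pair `s_0`, `s_1`, where no bound on the trace of
the matrix of `b` is available; the first desubstitution is therefore estimated by norms. -/
theorem IsFactor.norm_wordMat_le {w : List Letter} (hw : IsFactor w) (j : ℕ)
    (hj : w.length < 2 ^ j) :
    ‖wordMat A w‖ ≤ (1 + ‖A .a‖) * (1 + ‖A .b‖) *
        (1 + ‖fibMat A 0‖ + ‖fibMat A 1‖ + ‖fibMat A 0 * fibMat A 1‖) *
        (((2 * m + 1) ^ 2) ^ 6) ^ j := by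
  obtain ⟨p, v, s, hv, hp, hs, rfl⟩ := hw.desubst
  have hlen := length_le_length_subst v
  have h := hv.isComb hA hm ht j 0 (by
    simp only [List.length_append] at hj
    omega)
  obtain ⟨c₀, c₁, c₂, c₃, h₀, h₁, h₂, h₃, e⟩ := h
  set R := (((2 * m + 1) ^ 2) ^ 6) ^ j
  rw [wordMat_append, wordMat_append, wordMat_subst, e, zero_add]
  have hp1 : ‖wordMat A p‖ ≤ 1 + ‖A .b‖ := by
    rcases hp with rfl | rfl <;> simp
  have hs1 : ‖wordMat A s‖ ≤ 1 + ‖A .a‖ := by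
    rcases hs with rfl | rfl <;> simp
  have hc : ‖c₀ • (1 : Matrix (Fin 2) (Fin 2) ℂ) + c₁ • fibMat A 0 + c₂ • fibMat A 1
      + c₃ • (fibMat A 0 * fibMat A 1)‖ ≤
      R * (1 + ‖fibMat A 0‖ + ‖fibMat A 1‖ + ‖fibMat A 0 * fibMat A 1‖) := by
    refine norm_add₄_le.trans ?_
    simp only [norm_smul, norm_one]
    calc _ ≤ R * 1 + R * ‖fibMat A 0‖ + R * ‖fibMat A 1‖ + R * ‖fibMat A 0 * fibMat A 1‖ := by
          gcongr
      _ = _ := by ring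
  calc _ ≤ (1 + ‖A .a‖) * ((R * (1 + ‖fibMat A 0‖ + ‖fibMat A 1‖ + ‖fibMat A 0 * fibMat A 1‖))
        * (1 + ‖A .b‖)) := by
        refine (norm_mul_le _ _).trans (mul_le_mul hs1 ((norm_mul_le _ _).trans
          (mul_le_mul hc hp1 (norm_nonneg _) ((norm_nonneg _).trans hc))) (norm_nonneg _)
          (by positivity))
    _ = _ := by ring

end Comb

/-! ### Squares in the Fibonacci word -/

/-- The prefix of length `n` of the infinite word `u`. -/
def uPrefix (n : ℕ) : List Letter := (List.range n).map fibU

@[simp] theorem length_uPrefix (n : ℕ) : (uPrefix n).length = n := by simp [uPrefix]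

theorem uPrefix_succ (n : ℕ) : uPrefix (n + 1) = uPrefix n ++ [fibU n] := by
  simp [uPrefix, List.range_succ]

theorem eq_uPrefix_of_prefix {w : List Letter} {k : ℕ} (h : w <+: fibWord k) :
    w = uPrefix w.length := by
  refine List.ext_getElem (by simp) fun i h₁ h₂ => ?_
  have e₁ : w[i] = (fibWord (max i k))[i]'(by
      have := (h.trans (fibWord_prefix_of_le (le_max_right i k))).length_le; omega) :=
    (h.trans (fibWord_prefix_of_le (le_max_right i k))).getElem h₁
  have e₂ : fibU i = (fibWord (max i k))[i]'(by
      have := (h.trans (fibWord_prefix_of_le (le_max_right i k))).length_le; omega) :=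
    (fibWord_prefix_of_le (le_max_left i k)).getElem (lt_length_fibWord i)
  simp [uPrefix, e₁, e₂]

theorem uPrefix_prefix_fibWord (n : ℕ) : uPrefix n <+: fibWord n := by
  have h := eq_uPrefix_of_prefix (List.take_prefix n (fibWord n))
  rw [List.length_take, min_eq_left (lt_length_fibWord n).le] at h
  exact h ▸ List.take_prefix _ _

/-- The position in `u` of the image under `S` of the gap before the letter `u_n`. -/
def substPos (n : ℕ) : ℕ := (subst (uPrefix n)).length

theorem prefix_subst_mono {v w : List Letter} (h : v <+: w) : subst v <+: subst w := by
  obtain ⟨t, rfl⟩ := h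
  exact ⟨subst t, (subst_append _ _).symm⟩

theorem subst_uPrefix (n : ℕ) : subst (uPrefix n) = uPrefix (substPos n) :=
  eq_uPrefix_of_prefix (k := n + 1)
    (fibWord_succ n ▸ prefix_subst_mono (uPrefix_prefix_fibWord n))

theorem uPrefix_substPos_succ (n : ℕ) :
    uPrefix (substPos (n + 1)) = uPrefix (substPos n) ++ substLetter (fibU n) := by
  rw [← subst_uPrefix, ← subst_uPrefix, uPrefix_succ, subst_append]
  simp [subst]

theorem substPos_succ (n : ℕ) : substPos (n + 1) = substPos n + (substLetter (fibU n)).length := by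
  simpa using congrArg List.length (uPrefix_substPos_succ n)

theorem substPos_succ_of_a {n : ℕ} (h : fibU n = .a) : substPos (n + 1) = substPos n + 2 := by
  rw [substPos_succ, h]; rfl

theorem substPos_succ_of_b {n : ℕ} (h : fibU n = .b) : substPos (n + 1) = substPos n + 1 := by
  rw [substPos_succ, h]; rfl

theorem fibU_substPos (n : ℕ) : fibU (substPos n) = .a := by
  have h := uPrefix_substPos_succ n
  rcases hn : fibU n with _ | _
  · rw [substPos_succ_of_a hn, uPrefix_succ, uPrefix_succ, hn, List.append_assoc,
      List.append_cancel_left_eq] at h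
    simp [substLetter] at h
    exact h.1
  · rw [substPos_succ_of_b hn, uPrefix_succ, hn, List.append_cancel_left_eq] at h
    simpa [substLetter] using h

theorem fibU_substPos_add_one {n : ℕ} (hn : fibU n = .a) : fibU (substPos n + 1) = .b := by
  have h := uPrefix_substPos_succ n
  rw [substPos_succ_of_a hn, uPrefix_succ, uPrefix_succ, hn, List.append_assoc,
    List.append_cancel_left_eq] at h
  simp [substLetter] at h
  exact h.2

theorem exists_substPos (g : ℕ) :
    ∃ h, g = substPos h ∨ (fibU h = .a ∧ g = substPos h + 1) := by
  induction g with
  | zero => exact ⟨0, .inl rfl⟩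
  | succ g ih =>
    obtain ⟨h, rfl | ⟨ha, rfl⟩⟩ := ih
    · rcases e : fibU h with _ | _
      · exact ⟨h, .inr ⟨e, rfl⟩⟩
      · exact ⟨h + 1, .inl (substPos_succ_of_b e).symm⟩
    · exact ⟨h + 1, .inl (substPos_succ_of_a ha).symm⟩

theorem substPos_le (n : ℕ) : substPos n ≤ 2 * n := by
  induction n with
  | zero => exact le_rfl
  | succ n ih => 
    rcases e : fibU n with _ | _
    · rw [substPos_succ_of_a e]; omega
    · rw [substPos_succ_of_b e]; omega

theorem fibU_succ_of_b {n : ℕ} (h : fibU n = .b) : fibU (n + 1) = .a := by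
  obtain ⟨i, rfl | ⟨ha, rfl⟩⟩ := exists_substPos n
  · simp [fibU_substPos] at h
  · have := fibU_substPos (i + 1)
    rwa [substPos_succ_of_a ha] at this

theorem fibU_add_two_of_a_a {n : ℕ} (h₀ : fibU n = .a) (h₁ : fibU (n + 1) = .a) :
    fibU (n + 2) = .b := by
  obtain ⟨i, rfl | ⟨ha, rfl⟩⟩ := exists_substPos n
  · rcases e : fibU i with _ | _
    · simp [fibU_substPos_add_one e] at h₁
    · have := fibU_substPos_add_one (fibU_succ_of_b e)
      rwa [substPos_succ_of_b e] at this
  · simp [fibU_substPos_add_one ha] at h₀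

/-- The gap before `u_g` is the centre of a square `v v` in `u`, with `v` a rotation of `s_j`. -/
def IsCentre (j g : ℕ) : Prop :=
  ∃ l v, v ~r fibWord j ∧ l ++ v = uPrefix g ∧ l ++ v ++ v = uPrefix (g + v.length)

theorem isRotated_subst {v w : List Letter} (h : v ~r w) : subst v ~r subst w := by
  obtain ⟨n, rfl⟩ := h
  induction n generalizing v with
  | zero => simpa using List.IsRotated.refl _
  | succ n ih =>
    cases v with
    | nil => simp
    | cons l v =>
      rw [List.rotate_cons_succ]
      refine List.IsRotated.trans ?_ ih
      rw [subst_cons, subst_append]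
      simpa [subst] using List.isRotated_append

theorem IsCentre.subst {j g : ℕ} (h : IsCentre j g) : IsCentre (j + 1) (substPos g) := by
  obtain ⟨l, v, hv, h₁, h₂⟩ := h
  have e₁ := congrArg FibCMV.subst h₁
  have e₂ := congrArg FibCMV.subst h₂
  rw [subst_uPrefix] at e₁ e₂
  simp only [subst_append] at e₁ e₂
  refine ⟨FibCMV.subst l, FibCMV.subst v, fibWord_succ j ▸ isRotated_subst hv, e₁, ?_⟩
  have hlen := congrArg List.length e₂
  rw [List.length_append, e₁, length_uPrefix, length_uPrefix] at hlen
  rw [hlen, e₂]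

/-- Images of letters under `S` all start with `a`, so that the image of a square can be shifted
to the right by one letter. -/
theorem IsCentre.subst_succ {j g : ℕ} (h : IsCentre j g) : IsCentre (j + 1) (substPos g + 1) := by
  obtain ⟨l, v, hv, h₁, h₂⟩ := h
  have hv' := fibWord_succ j ▸ isRotated_subst hv
  have e₁ := congrArg FibCMV.subst h₁
  have e₂ := congrArg FibCMV.subst h₂
  rw [subst_uPrefix] at e₁ e₂
  simp only [subst_append] at e₁ e₂
  obtain ⟨t, ht⟩ : ∃ t, FibCMV.subst v = .a :: t := by
    cases v with
    | nil => exact absurd hv.perm.length_eq.symm (by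
        simpa using (Nat.zero_le j).trans_lt (lt_length_fibWord j) |>.ne')
    | cons x v => cases x <;> exact ⟨_, subst_cons _ _⟩
  have hlen := congrArg List.length e₂
  rw [List.length_append, e₁, length_uPrefix, length_uPrefix, ht] at hlen
  refine ⟨FibCMV.subst l ++ [.a], t ++ [.a], ?_, ?_, ?_⟩
  · refine List.IsRotated.trans ?_ hv'
    rw [ht]
    exact List.isRotated_append (l := t) (l' := [.a])
  · rw [uPrefix_succ, fibU_substPos, ← e₁, ht]
    simp
  · have e₃ : uPrefix (substPos (g + v.length) + 1) =
        FibCMV.subst l ++ FibCMV.subst v ++ FibCMV.subst v ++ [.a] := by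
      rw [uPrefix_succ, fibU_substPos, e₂]
    rw [show substPos g + 1 + (t ++ [Letter.a]).length = substPos (g + v.length) + 1 by
      rw [← hlen]; simp; omega, e₃, ht]
    simp

/-- The gap before `u_g` is the centre of a square whose period is `|s_k|`, `|s_{k+1}|` or
`|s_{k+2}|`. -/
def IsCentreNear (k g : ℕ) : Prop := ∃ j, k ≤ j ∧ j ≤ k + 2 ∧ IsCentre j g

/-- Either the gap before `u_{g+1}` is a centre, or it separates distinct letters and both
neighbouring gaps are centres. This property is inherited by the images under `S`. -/
def IsAlmostCentre (k g : ℕ) : Prop :=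
  IsCentreNear k (g + 1) ∨
    (IsCentreNear k g ∧ IsCentreNear k (g + 2) ∧ fibU g ≠ fibU (g + 1))

theorem isCentre_zero {h : ℕ} (e : fibU h = fibU (h + 1)) (ha : fibU h = .a) :
    IsCentre 0 (h + 1) := by
  refine ⟨uPrefix h, [.a], List.IsRotated.refl _, ?_, ?_⟩ <;> simp [uPrefix_succ, ← e, ha]

theorem isCentre_one {h : ℕ} (e₀ : fibU h = fibU (h + 2)) (e₁ : fibU (h + 1) = fibU (h + 3))
    (hr : [fibU h, fibU (h + 1)] ~r fibWord 1) : IsCentre 1 (h + 2) := by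
  refine ⟨uPrefix h, _, hr, ?_, ?_⟩ <;> simp [uPrefix_succ, ← e₀, ← e₁]

theorem isCentre_two {h : ℕ} (e₀ : fibU h = fibU (h + 3)) (e₁ : fibU (h + 1) = fibU (h + 4))
    (e₂ : fibU (h + 2) = fibU (h + 5))
    (hr : [fibU h, fibU (h + 1), fibU (h + 2)] ~r fibWord 2) : IsCentre 2 (h + 3) := by
  refine ⟨uPrefix h, _, hr, ?_, ?_⟩ <;> simp [uPrefix_succ, ← e₀, ← e₁, ← e₂]

/-- The only gaps with squares of periods neither `1`, `2` nor `3` are those in `baa|bab` and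
`bab|aab`. -/
theorem isAlmostCentre_zero (h : ℕ) : IsAlmostCentre 0 (h + 2) := by
  have hb := fun i => @fibU_succ_of_b (h + i)
  have haa := fun i => @fibU_add_two_of_a_a (h + i)
  have z₁ := fun i e => @isCentre_zero (h + i) e
  have z₂ := fun i e e' => @isCentre_one (h + i) e e'
  have z₃ := @isCentre_two h
  have r₁ : [Letter.a, .b] ~r fibWord 1 := List.IsRotated.refl _
  have r₂ : [Letter.b, .a] ~r fibWord 1 := ⟨1, rfl⟩
  have s₁ : [Letter.a, .b, .a] ~r fibWord 2 := List.IsRotated.refl _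
  have s₂ : [Letter.b, .a, .a] ~r fibWord 2 := ⟨2, rfl⟩
  have s₃ : [Letter.a, .a, .b] ~r fibWord 2 := ⟨1, rfl⟩
  have n₀ : ∀ {g}, IsCentre 0 g → IsCentreNear 0 g := fun c => ⟨0, le_rfl, by omega, c⟩
  have n₁ : ∀ {g}, IsCentre 1 g → IsCentreNear 0 g := fun c => ⟨1, by omega, by omega, c⟩
  have n₂ : ∀ {g}, IsCentre 2 g → IsCentreNear 0 g := fun c => ⟨2, by omega, le_rfl, c⟩
  have hb₀ := hb 0; have hb₁ := hb 1; have hb₂ := hb 2; have hb₃ := hb 3; have hb₄ := hb 4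
  have ha₀ := haa 0; have ha₁ := haa 1; have ha₂ := haa 2; have ha₃ := haa 3
  have c₁ := z₁ 1; have c₂ := z₁ 2; have c₃ := z₁ 3
  have d₀ := z₂ 0; have d₁ := z₂ 1; have d₂ := z₂ 2
  clear hb haa z₁ z₂
  unfold IsAlmostCentre
  rcases x₀ : fibU h with _ | _ <;> rcases x₁ : fibU (h + 1) with _ | _ <;>
  rcases x₂ : fibU (h + 2) with _ | _ <;> rcases x₃ : fibU (h + 3) with _ | _ <;>
  rcases x₄ : fibU (h + 4) with _ | _ <;> rcases x₅ : fibU (h + 5) with _ | _ <;>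
  simp_all

theorem IsCentreNear.subst {k g : ℕ} (h : IsCentreNear k g) :
    IsCentreNear (k + 1) (substPos g) := by
  obtain ⟨j, h₁, h₂, h⟩ := h
  exact ⟨j + 1, by omega, by omega, h.subst⟩

theorem IsCentreNear.subst_succ {k g : ℕ} (h : IsCentreNear k g) :
    IsCentreNear (k + 1) (substPos g + 1) := by
  obtain ⟨j, h₁, h₂, h⟩ := h
  exact ⟨j + 1, by omega, by omega, h.subst_succ⟩

/-- All gaps far enough to the right are almost centres. Every gap of `u = S(u)` is the image of a
gap, or lies directly behind the image of a gap followed by `a`. Near a gap that is not a centre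
but separates `a` from `b`, the shifted images of the neighbouring centres leave at most one gap
uncovered, which again separates two distinct letters and has centres on both sides. -/
theorem exists_isAlmostCentre (k : ℕ) : ∃ W, ∀ g, W ≤ g → IsAlmostCentre k g := by
  induction k with
  | zero =>
    refine ⟨2, fun g hg => ?_⟩
    obtain ⟨h, rfl⟩ := Nat.exists_eq_add_of_le' hg
    exact isAlmostCentre_zero h
  | succ k ih =>
    obtain ⟨W, hW⟩ := ih
    refine ⟨2 * W + 2, fun G hG => ?_⟩
    obtain ⟨h, hh⟩ := exists_substPos (G + 1)
    have hpos := substPos_le h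
    obtain ⟨g, rfl⟩ : ∃ g, h = g + 1 := ⟨h - 1, by omega⟩
    rcases hW g (by omega) with hc | ⟨hc₀, hc₂, hne⟩
    · rcases hh with e | ⟨_, e⟩
      · exact .inl (e ▸ hc.subst)
      · exact .inl (e ▸ hc.subst_succ)
    · rcases e₀ : fibU g with _ | _
      -- `a | b` becomes `a b | a`: only the image of the gap may fail to be a centre.
      · have e₁ : fibU (g + 1) = .b := by
          rcases e₁ : fibU (g + 1) with _ | _
          · exact absurd (e₀.trans e₁.symm) hne
          · rfl
        rw [e₁] at hh
        have s₀ := substPos_succ_of_a e₀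
        have s₁ : substPos (g + 2) = _ := substPos_succ_of_b e₁
        obtain e : G + 1 = substPos g + 2 := by simpa [s₀] using hh
        obtain rfl : G = substPos g + 1 := by omega
        refine .inr ⟨hc₀.subst_succ, ?_, ?_⟩
        · have := hc₂.subst
          rwa [s₁, s₀] at this
        · have := fibU_substPos (g + 1)
          rw [s₀] at this
          rw [fibU_substPos_add_one e₀, this]
          simp
      -- `b | a` becomes `a | a b`: only the gap inside the block `a b` may fail to be a centre.
      · have e₁ : fibU (g + 1) = .a := fibU_succ_of_b e₀
        have s₀ := substPos_succ_of_b e₀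
        have s₁ : substPos (g + 2) = _ := substPos_succ_of_a e₁
        rw [s₀] at hh
        rcases hh with e | ⟨_, e⟩
        · exact .inl (e ▸ hc₀.subst_succ)
        · obtain rfl : G = substPos g + 1 := by omega
          refine .inr ⟨hc₀.subst_succ, ?_, ?_⟩
          · have := hc₂.subst
            rwa [s₁, s₀] at this
          · have h₁ := fibU_substPos (g + 1)
            have h₂ := fibU_substPos_add_one e₁
            rw [s₀] at h₁ h₂
            rw [h₁, h₂]
            simp

/-- The word of length `p` read in `ω` from position `n` on. -/
def window (ω : ℤ → Letter) (n : ℤ) (p : ℕ) : List Letter :=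
  (List.range p).map fun i : ℕ => ω (n + i)

@[simp] theorem length_window (ω : ℤ → Letter) (n : ℤ) (p : ℕ) :
    (window ω n p).length = p := by simp [window]

theorem window_succ (ω : ℤ → Letter) (n : ℤ) (p : ℕ) :
    window ω n (p + 1) = window ω n p ++ [ω (n + p)] := by
  simp [window, List.range_succ]

theorem isFactor_window {ω : ℤ → Letter} (hω : ω ∈ Omega) (n : ℤ) (p : ℕ) :
    IsFactor (window ω n p) := by
  obtain ⟨q, hq⟩ := hω n p
  refine ⟨q + p, List.IsInfix.trans ?_ (uPrefix_prefix_fibWord (q + p)).isInfix⟩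
  refine List.IsSuffix.isInfix ⟨uPrefix q, ?_⟩
  rw [uPrefix, uPrefix, List.range_add, List.map_append, List.map_map, List.append_cancel_left_eq]
  exact List.map_congr_left fun i hi => hq i (List.mem_range.1 hi)

/-- At every site `n` of `ω ∈ Ω`, the gap before `n` or the one before `n + 1` is the centre of a
square whose root is a rotation of `s_k`, `s_{k+1}` or `s_{k+2}`. -/
theorem exists_square {ω : ℤ → Letter} (hω : ω ∈ Omega) (k : ℕ) (n : ℤ) :
    ∃ e : ℤ, (e = 0 ∨ e = 1) ∧ ∃ j, k ≤ j ∧ j ≤ k + 2 ∧ ∃ v, v ~r fibWord j ∧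
      window ω (n + e - v.length) v.length = v ∧ window ω (n + e) v.length = v := by
  obtain ⟨W, hW⟩ := exists_isAlmostCentre k
  -- The part of `ω` that is compared with `u` extends far enough to the left of `n` for the gap to
  -- correspond to one beyond `W`.
  set N := W + (fibWord (k + 2)).length with hN
  obtain ⟨p, hp⟩ := hω (n - N) (2 * N + 2)
  obtain ⟨e, he, j, h₁, h₂, l, v, hv, e₁, e₂⟩ :
      ∃ e : ℕ, e ≤ 1 ∧ IsCentreNear k (p + N + e) := by
    rcases hN' : p + N with _ | g
    · have := (Nat.zero_le _).trans_lt (lt_length_fibWord (k + 2))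
      omega
    rcases hW g (by have := (Nat.zero_le _).trans_lt (lt_length_fibWord (k + 2)); omega)
      with hc | ⟨-, hc, -⟩
    · exact ⟨0, by omega, hc⟩
    · exact ⟨1, le_rfl, hc⟩
  have hlen : v.length ≤ N := by
    have := (fibWord_prefix_of_le h₂).length_le
    have := hv.perm.length_eq
    omega
  have hl : l.length + v.length = p + N + e := by simpa using congrArg List.length e₁
  have key : ∀ i (hi : i < v.length), fibU (l.length + i) = v[i] ∧
      fibU (l.length + v.length + i) = v[i] := by
    intro i hi
    have f : ∀ q (hq : q < (l ++ v ++ v).length), fibU q = (l ++ v ++ v)[q] := by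
      intro q hq
      simp [e₂, uPrefix]
    constructor
    · rw [f _ (by simp; omega)]
      simp [hi]
    · rw [f _ (by simp; omega)]
      simp [add_assoc]
  refine ⟨e, by omega, j, h₁, h₂, v, hv, ?_, ?_⟩
  · refine List.ext_getElem (by simp) fun i hi hi' => ?_
    have := hp (N + e - v.length + i) (by omega)
    rw [← (key i hi').1, show l.length + i = p + (N + e - v.length + i) by omega, ← this]
    simp only [window, List.getElem_map, List.getElem_range]
    congr 1
    push_cast [Nat.cast_sub (show v.length ≤ N + e by omega)]
    ring
  · refine List.ext_getElem (by simp) fun i hi hi' => ?_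
    have := hp (N + e + i) (by omega)
    rw [← (key i hi').2, show l.length + v.length + i = p + (N + e + i) by omega, ← this]
    simp only [window, List.getElem_map, List.getElem_range]
    congr 1
    push_cast
    ring

/-! ### The quantum walk as a unitary operator -/

theorem sin_sq_add_rho_sq (θ : ℝ) :
    ((Real.sin θ : ℝ) : ℂ) ^ 2 + (rho ((Real.sin θ : ℝ) : ℂ) : ℂ) ^ 2 = 1 := by
  have h : (rho ((Real.sin θ : ℝ) : ℂ)) ^ 2 = 1 - Real.sin θ ^ 2 := by
    rw [rho, Real.sq_sqrt] <;>
      simp [Complex.norm_real, -Complex.ofReal_sin, Real.abs_sin_le_one]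
  rw [← Complex.ofReal_pow, ← Complex.ofReal_pow, h]
  push_cast
  ring

theorem rho_sin_ne_zero {θ : ℝ} (hθ : θ ∈ Set.Ioo (-(Real.pi / 2)) (Real.pi / 2)) :
    (rho ((Real.sin θ : ℝ) : ℂ) : ℂ) ≠ 0 := by
  intro h
  have h₁ := sin_sq_add_rho_sq θ
  have h₂ := Real.sin_sq_add_cos_sq θ
  have h₃ := Real.cos_pos_of_mem_Ioo hθ
  rw [h] at h₁
  have h₄ : Real.sin θ ^ 2 + 0 ^ 2 = 1 := by exact_mod_cast h₁
  nlinarith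

@[simp] theorem rho_zero : rho 0 = 1 := by simp [rho]

section Walk

variable (θa θb : ℝ)

/-- The Verblunsky coefficient `sin θ_l` of the letter `l`. -/
abbrev letterSin (l : Letter) : ℂ := ((Real.sin (angle θa θb l) : ℝ) : ℂ)

theorem verblunsky_two_mul (ω : ℤ → Letter) (n : ℤ) :
    verblunsky θa θb ω (2 * n) = letterSin θa θb (ω n) := by
  simp [verblunsky]

theorem verblunsky_two_mul_add_one (ω : ℤ → Letter) (n : ℤ) :
    verblunsky θa θb ω (2 * n + 1) = 0 := by
  simp [verblunsky]

theorem verblunsky_two_mul_sub_one (ω : ℤ → Letter) (n : ℤ) :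
    verblunsky θa θb ω (2 * n - 1) = 0 := by
  rw [show 2 * n - 1 = 2 * (n - 1) + 1 by ring, verblunsky_two_mul_add_one]

theorem walkOperator_apply_two_mul (ω : ℤ → Letter) (ψ : ellTwo) (n : ℤ) :
    walkOperator θa θb ω ψ (2 * n) = letterSin θa θb (ω n) * ψ (2 * n - 1)
      + rho (letterSin θa θb (ω n)) * ψ (2 * n + 2) := by
  rw [walkOperator, extendedCMV_apply, show Finset.Icc (-2 : ℤ) 2 = {-2, -1, 0, 1, 2} by decide]
  simp [cmvEntry, verblunsky_two_mul, verblunsky_two_mul_add_one, verblunsky_two_mul_sub_one,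
    -Complex.ofReal_sin, ← sub_eq_add_neg, show 2 * n ≠ 2 * n - 1 by omega,
    show 2 * n + 1 ≠ 2 * n - 1 by omega, show 2 * n + 2 ≠ 2 * n - 1 by omega]

theorem walkOperator_apply_two_mul_add_one (ω : ℤ → Letter) (ψ : ellTwo) (n : ℤ) :
    walkOperator θa θb ω ψ (2 * n + 1) = rho (letterSin θa θb (ω n)) * ψ (2 * n - 1)
      - letterSin θa θb (ω n) * ψ (2 * n + 2) := by
  rw [walkOperator, extendedCMV_apply, show Finset.Icc (-2 : ℤ) 2 = {-2, -1, 0, 1, 2} by decide]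
  simp [cmvEntry, verblunsky_two_mul, verblunsky_two_mul_add_one, verblunsky_two_mul_sub_one,
    -Complex.ofReal_sin, ← sub_eq_add_neg, show 2 * n + 1 - 2 = 2 * n - 1 by ring,
    show 2 * n + 1 + 1 = 2 * n + 2 by ring, show 2 * n ≠ 2 * n - 1 by omega,
    show 2 * n + 1 ≠ 2 * n - 1 by omega, show 2 * n + 2 ≠ 2 * n - 1 by omega,
    show 2 * n + 1 + 2 ≠ 2 * n - 1 by omega, show ¬ Odd (2 * n) by simp]

theorem walkOperator_single_two_mul_sub_one (ω : ℤ → Letter) (n : ℤ) :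
    walkOperator θa θb ω (lp.single 2 (2 * n - 1) (1 : ℂ)) =
      letterSin θa θb (ω n) • lp.single 2 (2 * n) (1 : ℂ)
        + (rho (letterSin θa θb (ω n)) : ℂ) • lp.single 2 (2 * n + 1) (1 : ℂ) := by
  ext m
  simp only [lp.coeFn_add, lp.coeFn_smul, Pi.add_apply, Pi.smul_apply, smul_eq_mul,
    lp.coeFn_single, Pi.single_apply]
  obtain ⟨q, rfl | rfl⟩ := Int.even_or_odd' m
  · rw [walkOperator_apply_two_mul]
    simp only [lp.coeFn_single, Pi.single_apply]
    rcases eq_or_ne q n with rfl | hq <;> split_ifs <;> first | omega | simp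
  · rw [walkOperator_apply_two_mul_add_one]
    simp only [lp.coeFn_single, Pi.single_apply]
    rcases eq_or_ne q n with rfl | hq <;> split_ifs <;> first | omega | simp

theorem walkOperator_single_two_mul_add_two (ω : ℤ → Letter) (n : ℤ) :
    walkOperator θa θb ω (lp.single 2 (2 * n + 2) (1 : ℂ)) =
      (rho (letterSin θa θb (ω n)) : ℂ) • lp.single 2 (2 * n) (1 : ℂ)
        - letterSin θa θb (ω n) • lp.single 2 (2 * n + 1) (1 : ℂ) := by
  ext m
  simp only [lp.coeFn_sub, lp.coeFn_smul, Pi.sub_apply, Pi.smul_apply, smul_eq_mul,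
    lp.coeFn_single, Pi.single_apply]
  obtain ⟨q, rfl | rfl⟩ := Int.even_or_odd' m
  · rw [walkOperator_apply_two_mul]
    simp only [lp.coeFn_single, Pi.single_apply]
    rcases eq_or_ne q n with rfl | hq <;> split_ifs <;> first | omega | simp
  · rw [walkOperator_apply_two_mul_add_one]
    simp only [lp.coeFn_single, Pi.single_apply]
    rcases eq_or_ne q n with rfl | hq <;> split_ifs <;> first | omega | simp

theorem adjoint_walkOperator_apply_two_mul_sub_one (ω : ℤ → Letter) (φ : ellTwo) (n : ℤ) :
    star (walkOperator θa θb ω) φ (2 * n - 1) = letterSin θa θb (ω n) * φ (2 * n)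
      + rho (letterSin θa θb (ω n)) * φ (2 * n + 1) := by
  have h := lp.inner_single_left (𝕜 := ℂ) (2 * n - 1) (1 : ℂ) (star (walkOperator θa θb ω) φ)
  rw [ContinuousLinearMap.star_eq_adjoint, ContinuousLinearMap.adjoint_inner_right,
    walkOperator_single_two_mul_sub_one, inner_add_left, inner_smul_left, inner_smul_left,
    lp.inner_single_left, lp.inner_single_left] at h
  simp only [Complex.conj_ofReal, RCLike.inner_apply, map_one, mul_one] at h
  exact h.symm

theorem adjoint_walkOperator_apply_two_mul_add_two (ω : ℤ → Letter) (φ : ellTwo) (n : ℤ) :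
    star (walkOperator θa θb ω) φ (2 * n + 2) = rho (letterSin θa θb (ω n)) * φ (2 * n)
      - letterSin θa θb (ω n) * φ (2 * n + 1) := by
  have h := lp.inner_single_left (𝕜 := ℂ) (2 * n + 2) (1 : ℂ) (star (walkOperator θa θb ω) φ)
  rw [ContinuousLinearMap.star_eq_adjoint, ContinuousLinearMap.adjoint_inner_right,
    walkOperator_single_two_mul_add_two, inner_sub_left, inner_smul_left, inner_smul_left,
    lp.inner_single_left, lp.inner_single_left] at h
  simp only [Complex.conj_ofReal, RCLike.inner_apply, map_one, mul_one] at h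
  exact h.symm

theorem walkOperator_mem_unitary (ω : ℤ → Letter) :
    walkOperator θa θb ω ∈ unitary (ellTwo →L[ℂ] ellTwo) := by
  have hsc : ∀ n, letterSin θa θb (ω n) ^ 2 + (rho (letterSin θa θb (ω n)) : ℂ) ^ 2 = 1 :=
    fun n => sin_sq_add_rho_sq _
  rw [Unitary.mem_iff]
  constructor
  · ext φ m
    obtain ⟨q, rfl | rfl⟩ := Int.even_or_odd' m
    · obtain ⟨n, rfl⟩ : ∃ n, q = n + 1 := ⟨q - 1, by ring⟩
      rw [show 2 * (n + 1) = 2 * n + 2 by ring]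
      change star (walkOperator θa θb ω) (walkOperator θa θb ω φ) (2 * n + 2) = φ (2 * n + 2)
      rw [adjoint_walkOperator_apply_two_mul_add_two, walkOperator_apply_two_mul,
        walkOperator_apply_two_mul_add_one]
      linear_combination φ (2 * n + 2) * hsc n
    · obtain ⟨n, rfl⟩ : ∃ n, q = n - 1 := ⟨q + 1, by ring⟩
      rw [show 2 * (n - 1) + 1 = 2 * n - 1 by ring]
      change star (walkOperator θa θb ω) (walkOperator θa θb ω φ) (2 * n - 1) = φ (2 * n - 1)
      rw [adjoint_walkOperator_apply_two_mul_sub_one, walkOperator_apply_two_mul,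
        walkOperator_apply_two_mul_add_one]
      linear_combination φ (2 * n - 1) * hsc n
  · ext φ m
    obtain ⟨n, rfl | rfl⟩ := Int.even_or_odd' m
    · change walkOperator θa θb ω (star (walkOperator θa θb ω) φ) (2 * n) = φ (2 * n)
      rw [walkOperator_apply_two_mul, adjoint_walkOperator_apply_two_mul_add_two,
        adjoint_walkOperator_apply_two_mul_sub_one]
      linear_combination φ (2 * n) * hsc n
    · change walkOperator θa θb ω (star (walkOperator θa θb ω) φ) (2 * n + 1) = φ (2 * n + 1)
      rw [walkOperator_apply_two_mul_add_one, adjoint_walkOperator_apply_two_mul_add_two,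
        adjoint_walkOperator_apply_two_mul_sub_one]
      linear_combination φ (2 * n + 1) * hsc n

end Walk

/-- A spectral value of a normal operator is an approximate eigenvalue. -/
theorem notMem_spectrum_of_bound {H : Type*} [NormedAddCommGroup H] [InnerProductSpace ℂ H]
    [CompleteSpace H] {U : H →L[ℂ] H} (hU : IsStarNormal U) {z : ℂ} {C : ℝ}
    (h : ∀ ψ, ‖ψ‖ ≤ C * ‖U ψ - z • ψ‖) : z ∉ spectrum ℂ U := by
  rw [spectrum.notMem_iff]
  have hT : ∀ ψ, (algebraMap ℂ (H →L[ℂ] H) z - U) ψ = -(U ψ - z • ψ) := fun ψ => by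
    simp [Algebra.algebraMap_eq_smul_one]
  have hN : IsStarNormal (algebraMap ℂ (H →L[ℂ] H) z - U) := by
    constructor
    have hc := hU.star_comm_self.eq
    simp only [Commute, SemiconjBy, star_sub, Algebra.algebraMap_eq_smul_one, star_smul, star_one,
      sub_mul, mul_sub, smul_mul_assoc, mul_smul_comm, one_mul, mul_one, hc]
    module
  have hanti : AntilipschitzWith C.toNNReal (algebraMap ℂ (H →L[ℂ] H) z - U) :=
    ContinuousLinearMap.antilipschitz_of_bound _ fun ψ => by
      rw [hT, norm_neg]
      exact (h ψ).trans (by gcongr; exact Real.le_coe_toNNReal C)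
  rw [ContinuousLinearMap.isUnit_iff_bijective,
    ContinuousLinearMap.bijective_iff_dense_range_and_antilipschitz]
  refine ⟨?_, _, hanti⟩
  rw [Submodule.topologicalClosure_eq_top_iff, ContinuousLinearMap.IsStarNormal.orthogonal_range hN]
  exact LinearMap.ker_eq_bot.2 hanti.injective

/-! ### Approximate eigenvectors and squares -/

/-- `b` is nonnegative with `ℓ²(ℤ)`-norm at most `M`. -/
def L2Bound (b : ℤ → ℝ) (M : ℝ) : Prop :=
  0 ≤ M ∧ (∀ n, 0 ≤ b n) ∧ ∀ s : Finset ℤ, ∑ n ∈ s, b n ^ 2 ≤ M ^ 2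

namespace L2Bound

variable {b b' : ℤ → ℝ} {M M' : ℝ}

theorem add (h : L2Bound b M) (h' : L2Bound b' M') :
    L2Bound (fun n => b n + b' n) (M + M') := by
  obtain ⟨hM, hb, hs⟩ := h
  obtain ⟨hM', hb', hs'⟩ := h'
  refine ⟨add_nonneg hM hM', fun n => add_nonneg (hb n) (hb' n), fun s => ?_⟩
  have hc : ∑ n ∈ s, b n * b' n ≤ M * M' := by
    refine le_of_sq_le_sq ?_ (mul_nonneg hM hM')
    rw [mul_pow]
    exact (Finset.sum_mul_sq_le_sq_mul_sq _ _ _).trans (mul_le_mul (hs s) (hs' s)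
      (Finset.sum_nonneg fun _ _ => sq_nonneg _) (sq_nonneg _))
  calc ∑ n ∈ s, (b n + b' n) ^ 2
      = ∑ n ∈ s, b n ^ 2 + 2 * ∑ n ∈ s, b n * b' n + ∑ n ∈ s, b' n ^ 2 := by
        rw [Finset.mul_sum, ← Finset.sum_add_distrib, ← Finset.sum_add_distrib]
        exact Finset.sum_congr rfl fun _ _ => by ring
    _ ≤ M ^ 2 + 2 * (M * M') + M' ^ 2 := by
        have := hs s
        have := hs' s
        gcongr
    _ = (M + M') ^ 2 := by ring

theorem shift (h : L2Bound b M) (q : ℤ) : L2Bound (fun n => b (n + q)) M := by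
  refine ⟨h.1, fun n => h.2.1 _, fun s => ?_⟩
  simpa using h.2.2 (s.map (addRightEmbedding q))

theorem const_mul (h : L2Bound b M) {c : ℝ} (hc : 0 ≤ c) :
    L2Bound (fun n => c * b n) (c * M) := by
  refine ⟨mul_nonneg hc h.1, fun n => mul_nonneg hc (h.2.1 n), fun s => ?_⟩
  simp only [mul_pow, ← Finset.mul_sum]
  exact mul_le_mul_of_nonneg_left (h.2.2 s) (sq_nonneg c)

theorem mono (h : L2Bound b M) (hb' : ∀ n, 0 ≤ b' n) (hle : ∀ n, b' n ≤ b n) : L2Bound b' M :=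
  ⟨h.1, hb', fun s => (Finset.sum_le_sum fun n _ => pow_le_pow_left₀ (hb' n) (hle n) 2).trans
    (h.2.2 s)⟩

theorem sum {ι : Type*} (t : Finset ι) {c : ι → ℤ → ℝ} (h : ∀ i ∈ t, L2Bound (c i) M) :
    L2Bound (fun n => ∑ i ∈ t, c i n) (t.card * M) := by
  classical
  induction t using Finset.induction_on with
  | empty => exact ⟨by simp, by simp, by simp⟩
  | insert i t hi ih =>
    have := (h i (Finset.mem_insert_self _ _)).add
      (ih fun j hj => h j (Finset.mem_insert_of_mem hj))
    simp only [Finset.sum_insert hi, Finset.card_insert_of_notMem hi]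
    convert! this using 1
    push_cast
    ring

theorem of_ellTwo (ψ : ellTwo) : L2Bound (fun n => ‖ψ n‖) ‖ψ‖ :=
  ⟨norm_nonneg _, fun _ => norm_nonneg _, fun s => by
    simpa using lp.sum_rpow_le_norm_rpow (p := 2) (by norm_num) ψ s⟩

theorem norm_le {ψ : ellTwo} (h : L2Bound (fun n => ‖ψ n‖) M) : ‖ψ‖ ≤ M :=
  lp.norm_le_of_forall_sum_le (by norm_num) h.1 fun s => by simpa using h.2.2 s

end L2Bound

section Cocycle

variable {A : Letter → Matrix (Fin 2) (Fin 2) ℂ} {ω : ℤ → Letter} {Ψ : ℤ → Fin 2 → ℂ}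
  {E : ℤ → ℝ} {B : ℝ}

theorem norm_wordMat_le_pow (hB : 1 ≤ B) (hA : ∀ l, ‖A l‖ ≤ B) (w : List Letter) :
    ‖wordMat A w‖ ≤ B ^ w.length := by
  induction w with
  | nil => simp
  | cons l w ih =>
    rw [wordMat_cons, List.length_cons, pow_succ]
    exact (norm_mul_le _ _).trans (mul_le_mul ih (hA l) (norm_nonneg _) (by positivity))

theorem norm_sub_wordMat_mulVec_le (hB : 1 ≤ B) (hA : ∀ l, ‖A l‖ ≤ B)
    (hΨ : ∀ n, ‖Ψ (n + 1) - A (ω n) *ᵥ Ψ n‖ ≤ E n) (n : ℤ) (p : ℕ) :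
    ‖Ψ (n + p) - wordMat A (window ω n p) *ᵥ Ψ n‖ ≤ B ^ p * ∑ i ∈ Finset.range p, E (n + i) := by
  have hE : ∀ n, 0 ≤ E n := fun n => (norm_nonneg _).trans (hΨ n)
  induction p with
  | zero => simp [window]
  | succ p ih =>
    rw [window_succ, wordMat_append, Finset.sum_range_succ]
    have e : Ψ (n + (p + 1 : ℕ)) - (wordMat A [ω (n + p)] * wordMat A (window ω n p)) *ᵥ Ψ n
        = (Ψ (n + p + 1) - A (ω (n + p)) *ᵥ Ψ (n + p))
          + A (ω (n + p)) *ᵥ (Ψ (n + p) - wordMat A (window ω n p) *ᵥ Ψ n) := by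
      rw [mulVec_sub, mulVec_mulVec]
      push_cast
      simp [add_assoc]
    rw [e]
    refine (norm_add_le _ _).trans ?_
    have h₁ := hΨ (n + p)
    have h₂ : ‖A (ω (n + p)) *ᵥ (Ψ (n + p) - wordMat A (window ω n p) *ᵥ Ψ n)‖ ≤
        B * (B ^ p * ∑ i ∈ Finset.range p, E (n + i)) :=
      (linfty_opNorm_mulVec _ _).trans (mul_le_mul (hA _) ih (norm_nonneg _) (by linarith))
    have h₃ : E (n + p) ≤ B ^ (p + 1) * E (n + p) :=
      le_mul_of_one_le_left (hE _) (one_le_pow₀ hB)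
    calc _ ≤ B ^ (p + 1) * E (n + p) + B * (B ^ p * ∑ i ∈ Finset.range p, E (n + i)) :=
          add_le_add (h₁.trans h₃) h₂
      _ = _ := by ring

theorem sum_range_le_sum_Icc (hE : ∀ n, 0 ≤ E n) (n : ℤ) {q : ℤ} {p N : ℕ} (h₁ : -(N : ℤ) ≤ q)
    (h₂ : q + p ≤ N + 1) :
    ∑ i ∈ Finset.range p, E (n + q + i) ≤ ∑ i ∈ Finset.Icc (-N : ℤ) N, E (n + i) := by
  have e : ∑ i ∈ Finset.range p, E (n + q + i)
      = ∑ i ∈ (Finset.range p).image (fun i : ℕ => q + (i : ℤ)), E (n + i) := by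
    rw [Finset.sum_image fun i _ j _ h => by simpa using h]
    simp only [add_assoc]
  rw [e]
  refine Finset.sum_le_sum_of_subset_of_nonneg (fun i hi => ?_) fun _ _ _ => hE _
  simp only [Finset.mem_image, Finset.mem_range] at hi
  obtain ⟨i, hi, rfl⟩ := hi
  rw [Finset.mem_Icc]
  omega

/-- At the centre of a square whose root has large trace, an approximate orbit is much smaller
than at the two ends, by the Cayley–Hamilton theorem. -/
theorem norm_le_of_square (hB : 1 ≤ B) (hA : ∀ l, ‖A l‖ ≤ B) (hdet : ∀ l, (A l).det = 1)
    (hΨ : ∀ n, ‖Ψ (n + 1) - A (ω n) *ᵥ Ψ n‖ ≤ E n) {n : ℤ} {v : List Letter} {N : ℕ}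
    (hN : v.length ≤ N) (h₁ : window ω (n - v.length) v.length = v)
    (h₂ : window ω n v.length = v) {R : ℝ} (hR : 1 ≤ R) (ht : R ≤ ‖(wordMat A v).trace‖) :
    ‖Ψ n‖ ≤ R⁻¹ * (‖Ψ (n + v.length)‖ + ‖Ψ (n - v.length)‖)
      + 3 * B ^ (2 * N) * ∑ i ∈ Finset.Icc (-N : ℤ) N, E (n + i) := by
  have hE : ∀ n, 0 ≤ E n := fun n => (norm_nonneg _).trans (hΨ n)
  set p := v.length
  set P := wordMat A v
  set S := ∑ i ∈ Finset.Icc (-N : ℤ) N, E (n + i) with hS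
  have hS0 : 0 ≤ S := Finset.sum_nonneg fun _ _ => hE _
  have hP : ‖P‖ ≤ B ^ N := (norm_wordMat_le_pow hB hA v).trans (pow_le_pow_right₀ hB hN)
  have hBp : B ^ p ≤ B ^ N := pow_le_pow_right₀ hB hN
  have hB1 : 1 ≤ B ^ N := one_le_pow₀ hB
  set e₂ := Ψ (n + p) - P *ᵥ Ψ n with he₂
  set e₁ := Ψ n - P *ᵥ Ψ (n - p) with he₁
  have b₂ : ‖e₂‖ ≤ B ^ N * S := by
    have := norm_sub_wordMat_mulVec_le hB hA hΨ n p
    rw [h₂] at this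
    refine this.trans (mul_le_mul hBp ?_ (Finset.sum_nonneg fun _ _ => hE _) (by positivity))
    simpa using sum_range_le_sum_Icc hE n (q := 0) (by omega) (by omega)
  have b₁ : ‖e₁‖ ≤ B ^ N * S := by
    have := norm_sub_wordMat_mulVec_le hB hA hΨ (n - p) p
    rw [h₁, sub_add_cancel] at this
    refine this.trans (mul_le_mul hBp ?_ (Finset.sum_nonneg fun _ _ => hE _) (by positivity))
    simpa [sub_eq_add_neg] using sum_range_le_sum_Icc hE n (q := -p) (by omega) (by omega)
  -- For exact orbits (`e₁ = e₂ = 0`) this is `tr P • y = P y + P⁻¹ y` for `det P = 1`.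
  have key : P.trace • Ψ n = Ψ (n + p) + Ψ (n - p) - e₂ - P *ᵥ e₁ + P.trace • e₁ := by
    have hCH := congrArg (· *ᵥ Ψ (n - p)) (mul_self_eq_trace_smul P (det_wordMat A hdet v))
    simp only [← mulVec_mulVec, sub_mulVec, smul_mulVec, one_mulVec] at hCH
    rw [he₂, he₁, mulVec_sub, hCH]
    module
  have ht0 : 0 < ‖P.trace‖ := by linarith
  have hn : ‖P.trace‖ * ‖Ψ n‖ ≤ ‖Ψ (n + p)‖ + ‖Ψ (n - p)‖
      + (B ^ N * S + B ^ N * (B ^ N * S)) + ‖P.trace‖ * (B ^ N * S) := by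
    rw [← norm_smul, key]
    refine (norm_add_le _ _).trans (add_le_add ?_ ((norm_smul_le _ _).trans (by gcongr)))
    refine (norm_sub_le _ _).trans ?_
    refine (add_le_add (norm_sub_le _ _) ((linfty_opNorm_mulVec _ _).trans
      (mul_le_mul hP b₁ (norm_nonneg _) (by positivity)))).trans ?_
    linarith [norm_add_le (Ψ (n + p)) (Ψ (n - p))]
  have hq : ‖P.trace‖⁻¹ ≤ R⁻¹ := inv_anti₀ (by linarith) ht
  have hq1 : ‖P.trace‖⁻¹ ≤ 1 := inv_le_one_of_one_le₀ (hR.trans ht)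
  have hpos : 0 ≤ B ^ N * S + B ^ N * (B ^ N * S) := by positivity
  calc ‖Ψ n‖ = ‖P.trace‖⁻¹ * (‖P.trace‖ * ‖Ψ n‖) := by rw [inv_mul_cancel_left₀ ht0.ne']
    _ ≤ ‖P.trace‖⁻¹ * (‖Ψ (n + p)‖ + ‖Ψ (n - p)‖
      + (B ^ N * S + B ^ N * (B ^ N * S)) + ‖P.trace‖ * (B ^ N * S)) := by gcongr
    _ = ‖P.trace‖⁻¹ * (‖Ψ (n + p)‖ + ‖Ψ (n - p)‖)
      + ‖P.trace‖⁻¹ * (B ^ N * S + B ^ N * (B ^ N * S)) + B ^ N * S := by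
        field_simp
    _ ≤ R⁻¹ * (‖Ψ (n + p)‖ + ‖Ψ (n - p)‖)
      + 1 * (B ^ N * S + B ^ N * (B ^ N * S)) + B ^ N * S := by gcongr
    _ ≤ _ := by
        rw [pow_mul', sq]
        have : B ^ N * S ≤ B ^ N * (B ^ N * S) := le_mul_of_one_le_left (by positivity) hB1
        linarith

end Cocycle

/-! ### Boundedness of the traces on the spectrum -/

/-- The transfer matrix over one site of the walk, normalized by `z⁻¹` so that its determinant
is one. -/
def walkMat (θa θb : ℝ) (z : ℂ) (l : Letter) : Matrix (Fin 2) (Fin 2) ℂ :=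
  z⁻¹ • (transfer z 0 * transfer z (letterSin θa θb l))

section Spectrum

variable {θa θb : ℝ} {z : ℂ}

theorem walkMat_eq (hz : z ≠ 0) (l : Letter) :
    walkMat θa θb z l = (rho (letterSin θa θb l) : ℂ)⁻¹ •
      !![z, -letterSin θa θb l; -letterSin θa θb l, z⁻¹] := by
  have hs : star (letterSin θa θb l) = letterSin θa θb l := Complex.conj_ofReal _
  rw [walkMat, transfer, transfer, hs]
  generalize (rho (letterSin θa θb l) : ℂ)⁻¹ = c
  generalize letterSin θa θb l = s
  ext i j
  fin_cases i <;> fin_cases j <;> simp <;> field_simp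

variable (hθa : θa ∈ Set.Ioo (-(Real.pi / 2)) (Real.pi / 2))
  (hθb : θb ∈ Set.Ioo (-(Real.pi / 2)) (Real.pi / 2))
include hθa hθb

theorem rho_letterSin_ne_zero (l : Letter) : (rho (letterSin θa θb l) : ℂ) ≠ 0 := by
  cases l
  · exact rho_sin_ne_zero hθa
  · exact rho_sin_ne_zero hθb

theorem det_walkMat (hz : z ≠ 0) (l : Letter) : (walkMat θa θb z l).det = 1 := by
  have hc := rho_letterSin_ne_zero hθa hθb l
  have hsc : letterSin θa θb l ^ 2 + (rho (letterSin θa θb l) : ℂ) ^ 2 = 1 := sin_sq_add_rho_sq _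
  rw [walkMat_eq hz, det_smul, det_fin_two_of, Fintype.card_fin]
  generalize (rho (letterSin θa θb l) : ℂ) = c at *
  generalize letterSin θa θb l = s at *
  field_simp
  linear_combination -hsc

omit hθa hθb in
/-- The pair of coordinates of `ψ` on which the transfer matrix over the site `n` acts. -/
def sitePair (ψ : ellTwo) (n : ℤ) : Fin 2 → ℂ := ![ψ (2 * n), ψ (2 * n - 1)]

/-- An approximate solution of `ℰ_ω ψ = z ψ` is an approximate orbit of the transfer matrices. -/
theorem exists_norm_sitePair_succ_sub_le (hz : ‖z‖ = 1) : ∃ D : ℝ, 1 ≤ D ∧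
    ∀ (ω : ℤ → Letter) (ψ : ellTwo) (n : ℤ),
      ‖sitePair ψ (n + 1) - walkMat θa θb z (ω n) *ᵥ sitePair ψ n‖ ≤
        D * (‖(walkOperator θa θb ω ψ - z • ψ) (2 * n)‖
          + ‖(walkOperator θa θb ω ψ - z • ψ) (2 * n + 1)‖) := by
  have hz0 : z ≠ 0 := norm_ne_zero_iff.1 (by rw [hz]; exact one_ne_zero)
  refine ⟨1 + ‖(rho (letterSin θa θb .a) : ℂ)⁻¹‖ + ‖(rho (letterSin θa θb .b) : ℂ)⁻¹‖,
    by linarith [norm_nonneg (rho (letterSin θa θb .a) : ℂ)⁻¹,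
      norm_nonneg (rho (letterSin θa θb .b) : ℂ)⁻¹], fun ω ψ n => ?_⟩
  set D : ℝ := 1 + ‖(rho (letterSin θa θb .a) : ℂ)⁻¹‖ + ‖(rho (letterSin θa θb .b) : ℂ)⁻¹‖ with hD
  have h1D : 1 ≤ D := by
    linarith [norm_nonneg (rho (letterSin θa θb .a) : ℂ)⁻¹,
      norm_nonneg (rho (letterSin θa θb .b) : ℂ)⁻¹]
  have hcD : ‖(rho (letterSin θa θb (ω n)) : ℂ)⁻¹‖ ≤ D := by
    cases ω n <;> rw [hD] <;> linarith [norm_nonneg (rho (letterSin θa θb .a) : ℂ)⁻¹,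
      norm_nonneg (rho (letterSin θa θb .b) : ℂ)⁻¹]
  have hs1 : ‖letterSin θa θb (ω n)‖ ≤ 1 := by
    rw [Complex.norm_real]; exact Real.abs_sin_le_one _
  have hc := rho_letterSin_ne_zero hθa hθb (ω n)
  have hsc : letterSin θa θb (ω n) ^ 2 + (rho (letterSin θa θb (ω n)) : ℂ) ^ 2 = 1 :=
    sin_sq_add_rho_sq _
  have hf₀ : (walkOperator θa θb ω ψ - z • ψ) (2 * n) = _ - z * ψ (2 * n) :=
    congrArg (· - z * ψ (2 * n)) (walkOperator_apply_two_mul θa θb ω ψ n)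
  have hf₁ : (walkOperator θa θb ω ψ - z • ψ) (2 * n + 1) = _ - z * ψ (2 * n + 1) :=
    congrArg (· - z * ψ (2 * n + 1)) (walkOperator_apply_two_mul_add_one θa θb ω ψ n)
  rw [walkMat_eq hz0]
  generalize (walkOperator θa θb ω ψ - z • ψ) (2 * n) = f₀ at *
  generalize (walkOperator θa θb ω ψ - z • ψ) (2 * n + 1) = f₁ at *
  generalize (rho (letterSin θa θb (ω n)) : ℂ) = c at *
  generalize letterSin θa θb (ω n) = s at *
  have e : sitePair ψ (n + 1) - (c⁻¹ • !![z, -s; -s, z⁻¹]) *ᵥ sitePair ψ n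
      = ![c⁻¹ * f₀, -(z⁻¹ * (c⁻¹ * s * f₀ + f₁))] := by
    rw [sitePair, sitePair, show 2 * (n + 1) = 2 * n + 2 by ring,
      show 2 * n + 2 - 1 = 2 * n + 1 by ring, hf₀, hf₁]
    ext i
    fin_cases i
    · simp
      field_simp
      ring
    · simp
      field_simp
      linear_combination ψ (2 * n - 1) * hsc
  rw [e, pi_norm_le_iff_of_nonneg (by positivity)]
  intro i
  fin_cases i
  · calc ‖c⁻¹ * f₀‖ = ‖c⁻¹‖ * ‖f₀‖ := norm_mul _ _
      _ ≤ D * (‖f₀‖ + ‖f₁‖) := by gcongr; linarith [norm_nonneg f₁]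
  · calc ‖-(z⁻¹ * (c⁻¹ * s * f₀ + f₁))‖ = ‖c⁻¹ * s * f₀ + f₁‖ := by
          rw [norm_neg, norm_mul, norm_inv, hz, inv_one, one_mul]
      _ ≤ ‖c⁻¹‖ * ‖s‖ * ‖f₀‖ + ‖f₁‖ := (norm_add_le _ _).trans_eq (by rw [norm_mul, norm_mul])
      _ ≤ D * 1 * ‖f₀‖ + D * ‖f₁‖ := by
          gcongr
          exact le_mul_of_one_le_left (norm_nonneg _) h1D
      _ = D * (‖f₀‖ + ‖f₁‖) := by ring

omit hθa hθb in
/-- The index `m` belongs to the pair of the site `(m + 1) / 2`. -/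
theorem norm_apply_le_norm_sitePair (ψ : ellTwo) (m : ℤ) :
    ‖ψ m‖ ≤ ‖sitePair ψ ((m + 1) / 2)‖ := by
  obtain ⟨n, rfl | rfl⟩ := Int.even_or_odd' m
  · rw [show (2 * n + 1) / 2 = n by omega]
    exact norm_le_pi_norm (sitePair ψ n) 0
  · rw [show (2 * n + 1 + 1) / 2 = n + 1 by omega]
    have := norm_le_pi_norm (sitePair ψ (n + 1)) 1
    simpa [sitePair, show 2 * (n + 1) - 1 = 2 * n + 1 by ring] using this

omit hθa hθb in
theorem norm_sitePair_le (ψ : ellTwo) (m q : ℤ) :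
    ‖sitePair ψ ((m + 1) / 2 + q)‖ ≤
      ‖ψ (m + 2 * q + -1)‖ + ‖ψ (m + 2 * q)‖ + ‖ψ (m + 2 * q + 1)‖ := by
  rw [pi_norm_le_iff_of_nonneg (by positivity)]
  obtain ⟨n, rfl | rfl⟩ := Int.even_or_odd' m
  · rw [show (2 * n + 1) / 2 + q = n + q by omega]
    intro i
    fin_cases i
    · change ‖ψ (2 * (n + q))‖ ≤ _
      rw [show 2 * (n + q) = 2 * n + 2 * q by ring]
      linarith [norm_nonneg (ψ (2 * n + 2 * q + -1)), norm_nonneg (ψ (2 * n + 2 * q + 1))]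
    · change ‖ψ (2 * (n + q) - 1)‖ ≤ _
      rw [show 2 * (n + q) - 1 = 2 * n + 2 * q + -1 by ring]
      linarith [norm_nonneg (ψ (2 * n + 2 * q)), norm_nonneg (ψ (2 * n + 2 * q + 1))]
  · rw [show (2 * n + 1 + 1) / 2 + q = n + 1 + q by omega]
    intro i
    fin_cases i
    · change ‖ψ (2 * (n + 1 + q))‖ ≤ _
      rw [show 2 * (n + 1 + q) = 2 * n + 1 + 2 * q + 1 by ring]
      linarith [norm_nonneg (ψ (2 * n + 1 + 2 * q)), norm_nonneg (ψ (2 * n + 1 + 2 * q + -1))]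
    · change ‖ψ (2 * (n + 1 + q) - 1)‖ ≤ _
      rw [show 2 * (n + 1 + q) - 1 = 2 * n + 1 + 2 * q by ring]
      linarith [norm_nonneg (ψ (2 * n + 1 + 2 * q + -1)),
        norm_nonneg (ψ (2 * n + 1 + 2 * q + 1))]

omit hθa hθb in
theorem norm_add_norm_le (f : ellTwo) (m q : ℤ) :
    ‖f (2 * ((m + 1) / 2 + q))‖ + ‖f (2 * ((m + 1) / 2 + q) + 1)‖ ≤
      ‖f (m + 2 * q)‖ + ‖f (m + 2 * q + 1)‖ + ‖f (m + 2 * q + 2)‖ := by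
  obtain ⟨n, rfl | rfl⟩ := Int.even_or_odd' m
  · rw [show 2 * ((2 * n + 1) / 2 + q) = 2 * n + 2 * q by omega]
    linarith [norm_nonneg (f (2 * n + 2 * q + 2))]
  · rw [show 2 * ((2 * n + 1 + 1) / 2 + q) = 2 * n + 1 + 2 * q + 1 by omega,
      show 2 * n + 1 + 2 * q + 1 + 1 = 2 * n + 1 + 2 * q + 2 by ring]
    linarith [norm_nonneg (f (2 * n + 1 + 2 * q))]

omit hθa hθb in
/-- At every site an approximate orbit is controlled by its values at twelve sites, with a small
factor if the traces of three consecutive Fibonacci words are large. -/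
theorem norm_le_sum_of_traces_large {A : Letter → Matrix (Fin 2) (Fin 2) ℂ} {B R : ℝ} {k : ℕ}
    (hB : 1 ≤ B) (hA : ∀ l, ‖A l‖ ≤ B) (hadj : ∀ l, ‖(A l).adjugate‖ ≤ B)
    (hdet : ∀ l, (A l).det = 1) (hR : 1 ≤ R)
    (ht : ∀ j, k ≤ j → j ≤ k + 2 → R ≤ ‖(fibMat A j).trace‖) :
    ∃ C : ℝ, 0 ≤ C ∧ ∃ N : ℕ, ∀ ω ∈ Omega, ∀ (Ψ : ℤ → Fin 2 → ℂ) (E : ℤ → ℝ),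
      (∀ n, ‖Ψ (n + 1) - A (ω n) *ᵥ Ψ n‖ ≤ E n) → ∀ n,
      ‖Ψ n‖ ≤ B * R⁻¹ * ∑ j ∈ Finset.Icc k (k + 2),
          (‖Ψ (n + (fibWord j).length)‖ + ‖Ψ (n + -(fibWord j).length)‖
            + ‖Ψ (n + (1 + (fibWord j).length))‖ + ‖Ψ (n + (1 - (fibWord j).length))‖)
        + C * ∑ i ∈ Finset.Icc (-N : ℤ) N, E (n + i) := by
  set M := (fibWord (k + 2)).length
  refine ⟨B * (3 * B ^ (2 * M) + 1), by positivity, M + 1, fun ω hω Ψ E hΨ n => ?_⟩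
  have hE : ∀ n, 0 ≤ E n := fun n => (norm_nonneg _).trans (hΨ n)
  obtain ⟨e, he, j, hkj, hjk, v, hv, h₁, h₂⟩ := exists_square hω k n
  have hlen : v.length = (fibWord j).length := hv.perm.length_eq
  have hM : v.length ≤ M := hlen.trans_le (fibWord_prefix_of_le hjk).length_le
  have hsq := norm_le_of_square hB hA hdet hΨ hM h₁ h₂ hR
    ((ht j hkj hjk).trans_eq (by rw [trace_wordMat_of_isRotated A hv]; rfl))
  rw [hlen] at hsq
  have hstep : ‖Ψ n‖ ≤ B * (‖Ψ (n + e)‖ + E n) := by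
    rcases he with rfl | rfl
    · rw [add_zero]
      nlinarith [norm_nonneg (Ψ n), hE n]
    · have e₁ : Ψ n = (A (ω n)).adjugate *ᵥ (Ψ (n + 1) - (Ψ (n + 1) - A (ω n) *ᵥ Ψ n)) := by
        rw [sub_sub_cancel, mulVec_mulVec, adjugate_mul, hdet, one_smul, one_mulVec]
      rw [e₁]
      refine (linfty_opNorm_mulVec _ _).trans (mul_le_mul (hadj _) ?_ (norm_nonneg _) (by linarith))
      exact (norm_sub_le _ _).trans (add_le_add le_rfl (hΨ n))
  set S := ∑ i ∈ Finset.Icc (-(M + 1 : ℕ) : ℤ) (M + 1 : ℕ), E (n + i) with hS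
  have hEn : E n ≤ S := by
    have := Finset.single_le_sum (f := fun i => E (n + i)) (fun i _ => hE (n + i))
      (show (0 : ℤ) ∈ Finset.Icc (-(M + 1 : ℕ) : ℤ) (M + 1 : ℕ) by rw [Finset.mem_Icc]; omega)
    rwa [add_zero] at this
  have hSe : ∑ i ∈ Finset.Icc (-M : ℤ) M, E (n + e + i) ≤ S := by
    have e₁ : ∑ i ∈ Finset.Icc (-M : ℤ) M, E (n + e + i)
        = ∑ i ∈ (Finset.Icc (-M : ℤ) M).image (e + ·), E (n + i) := by
      rw [Finset.sum_image fun i _ j _ h => by simpa using h]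
      simp only [add_assoc]
    rw [e₁, hS]
    refine Finset.sum_le_sum_of_subset_of_nonneg (fun i hi => ?_) fun _ _ _ => hE _
    simp only [Finset.mem_image, Finset.mem_Icc] at hi
    obtain ⟨i, hi, rfl⟩ := hi
    rw [Finset.mem_Icc]
    omega
  have hends : ‖Ψ (n + e + (fibWord j).length)‖ + ‖Ψ (n + e - (fibWord j).length)‖ ≤
      ∑ j ∈ Finset.Icc k (k + 2),
          (‖Ψ (n + (fibWord j).length)‖ + ‖Ψ (n + -(fibWord j).length)‖
            + ‖Ψ (n + (1 + (fibWord j).length))‖ + ‖Ψ (n + (1 - (fibWord j).length))‖) := by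
    refine le_trans ?_ (Finset.single_le_sum (fun j _ => by positivity)
      (Finset.mem_Icc.2 ⟨hkj, hjk⟩))
    rcases he with rfl | rfl
    · rw [add_zero, sub_eq_add_neg]
      linarith [norm_nonneg (Ψ (n + (1 + (fibWord j).length))),
        norm_nonneg (Ψ (n + (1 - (fibWord j).length)))]
    · rw [add_assoc n, add_sub_assoc n]
      linarith [norm_nonneg (Ψ (n + (fibWord j).length)),
        norm_nonneg (Ψ (n + -(fibWord j).length))]
  have hR0 : 0 ≤ R⁻¹ := by positivity
  calc ‖Ψ n‖ ≤ B * (‖Ψ (n + e)‖ + E n) := hstep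
    _ ≤ B * ((R⁻¹ * _ + 3 * B ^ (2 * M) * S) + S) := by
      gcongr
      refine hsq.trans (add_le_add (mul_le_mul_of_nonneg_left hends hR0) ?_)
      gcongr
    _ = _ := by ring

/-- If the traces of three consecutive Fibonacci words are large at a point of the unit circle,
then that point is not in the spectrum. -/
theorem notMem_spectrum_of_traces_large (hz : ‖z‖ = 1) {B : ℝ} {k : ℕ}
    (hB : 1 ≤ B) (hA : ∀ l, ‖walkMat θa θb z l‖ ≤ B)
    (hadj : ∀ l, ‖(walkMat θa θb z l).adjugate‖ ≤ B)
    (ht : ∀ j, k ≤ j → j ≤ k + 2 → 72 * B ≤ ‖(fibMat (walkMat θa θb z) j).trace‖)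
    {ω : ℤ → Letter} (hω : ω ∈ Omega) : z ∉ spectrum ℂ (walkOperator θa θb ω) := by
  have hz0 : z ≠ 0 := norm_ne_zero_iff.1 (by rw [hz]; exact one_ne_zero)
  obtain ⟨D, hD, hstep⟩ := exists_norm_sitePair_succ_sub_le hθa hθb hz
  obtain ⟨C, hC, N, hbound⟩ := norm_le_sum_of_traces_large hB hA hadj
    (det_walkMat hθa hθb hz0) (by linarith) ht
  have hU := Unitary.mem_iff.1 (walkOperator_mem_unitary θa θb ω)
  refine notMem_spectrum_of_bound ⟨hU.1.trans hU.2.symm⟩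
    (C := 2 * (C * ((Finset.Icc (-N : ℤ) N).card * (D * 3)))) fun ψ => ?_
  have hb := hbound ω hω (sitePair ψ) _ (hstep ω ψ)
  generalize walkOperator θa θb ω ψ - z • ψ = f at hb ⊢
  have hψ := L2Bound.of_ellTwo ψ
  have hf := L2Bound.of_ellTwo f
  have hg : ∀ q : ℤ, L2Bound (fun m => ‖sitePair ψ ((m + 1) / 2 + q)‖) (3 * ‖ψ‖) := fun q => by
    have h := (((hψ.shift (-1)).add hψ).add (hψ.shift 1)).shift (2 * q)
    rw [show ‖ψ‖ + ‖ψ‖ + ‖ψ‖ = 3 * ‖ψ‖ by ring] at h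
    exact h.mono (fun _ => norm_nonneg _) fun m => norm_sitePair_le ψ m q
  have hh : ∀ q : ℤ, L2Bound (fun m => D * (‖f (2 * ((m + 1) / 2 + q))‖
      + ‖f (2 * ((m + 1) / 2 + q) + 1)‖)) (D * 3 * ‖f‖) := fun q => by
    have h := (((hf.add (hf.shift 1)).add (hf.shift 2)).shift (2 * q)).const_mul
      (show 0 ≤ D by linarith)
    rw [show D * (‖f‖ + ‖f‖ + ‖f‖) = D * 3 * ‖f‖ by ring] at h
    exact h.mono (fun _ => by positivity) fun m =>
      mul_le_mul_of_nonneg_left (norm_add_norm_le f m q) (by linarith)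
  have hsum := ((L2Bound.sum (Finset.Icc k (k + 2)) fun j _ =>
      (((hg (fibWord j).length).add (hg (-(fibWord j).length))).add
        (hg (1 + (fibWord j).length))).add (hg (1 - (fibWord j).length))).const_mul
      (show 0 ≤ B * (72 * B)⁻¹ by positivity)).add
    ((L2Bound.sum (Finset.Icc (-N : ℤ) N) fun i _ => hh i).const_mul hC)
  have hle := L2Bound.norm_le (hsum.mono (b' := fun m => ‖ψ m‖) (fun _ => norm_nonneg _)
    fun m => (norm_apply_le_norm_sitePair ψ m).trans (hb _))
  -- The twelve values at other sites contribute `12 * 3 ‖ψ‖ / 72 = ‖ψ‖ / 2`.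
  rw [Nat.card_Icc, show k + 2 + 1 - k = 3 by omega,
    show B * (72 * B)⁻¹ = 1 / 72 by field_simp] at hle
  push_cast at hle
  linarith

omit hθa hθb in
theorem norm_eq_one_of_mem_walkSpectrum (hz : z ∈ walkSpectrum θa θb) : ‖z‖ = 1 := by
  simp only [walkSpectrum, Set.mem_iUnion] at hz
  obtain ⟨ω, -, h⟩ := hz
  exact spectrum.norm_eq_one_of_unitary (walkOperator_mem_unitary θa θb ω) h

theorem bddAbove_trace_of_mem_walkSpectrum (hz : z ∈ walkSpectrum θa θb) :
    BddAbove (Set.range fun k => ‖(fibMat (walkMat θa θb z) k).trace‖) := by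
  have hz1 := norm_eq_one_of_mem_walkSpectrum hz
  have hz0 : z ≠ 0 := norm_ne_zero_iff.1 (by rw [hz1]; exact one_ne_zero)
  by_contra hunb
  obtain ⟨B, hB, hA, hadj⟩ : ∃ B : ℝ, 1 ≤ B ∧ (∀ l, ‖walkMat θa θb z l‖ ≤ B) ∧
      ∀ l, ‖(walkMat θa θb z l).adjugate‖ ≤ B := by
    have h₁ := norm_nonneg (walkMat θa θb z .a)
    have h₂ := norm_nonneg (walkMat θa θb z .b)
    have h₃ := norm_nonneg (walkMat θa θb z .a).adjugate
    have h₄ := norm_nonneg (walkMat θa θb z .b).adjugate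
    refine ⟨1 + ‖walkMat θa θb z .a‖ + ‖walkMat θa θb z .b‖ + ‖(walkMat θa θb z .a).adjugate‖
      + ‖(walkMat θa θb z .b).adjugate‖, by linarith, fun l => ?_, fun l => ?_⟩ <;>
    cases l <;> linarith
  obtain ⟨k, h₀, h₁, h₂⟩ := exists_three_large (fun k => (fibMat (walkMat θa θb z) k).trace)
    (trace_fibMat_add_three (det_walkMat hθa hθb hz0)) hunb (72 * B)
  simp only [walkSpectrum, Set.mem_iUnion] at hz
  obtain ⟨ω, hω, h⟩ := hz
  refine notMem_spectrum_of_traces_large hθa hθb hz1 hB hA hadj (k := k) (fun j hj hj' => ?_) hω h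
  obtain rfl | rfl | rfl : j = k ∨ j = k + 1 ∨ j = k + 2 := by omega
  exacts [h₀.le, h₁.le, h₂.le]

end Spectrum

/-! ### Growth of the transfer matrices -/

theorem transferWord_append (z : ℂ) (v w : List ℂ) :
    transferWord z (v ++ w) = transferWord z w * transferWord z v := by
  induction v with
  | nil => simp [transferWord]
  | cons x v ih => simp [transferWord, ih, mul_assoc]

section Growth

variable {θa θb : ℝ} {z : ℂ}

theorem transfer_mul_transfer (hz : z ≠ 0) (l : Letter) :
    transfer z 0 * transfer z (letterSin θa θb l) = z • walkMat θa θb z l := by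
  rw [walkMat, smul_inv_smul₀ hz]

theorem transferWord_flatMap (hz : z ≠ 0) (w : List Letter) :
    transferWord z (w.flatMap fun l => [letterSin θa θb l, 0])
      = z ^ w.length • wordMat (walkMat θa θb z) w := by
  induction w with
  | nil => simp [transferWord]
  | cons l w ih =>
    rw [List.flatMap_cons, transferWord_append, ih]
    simp only [transferWord, one_mul, transfer_mul_transfer hz, wordMat_cons, List.length_cons,
      smul_mul_smul_comm, pow_succ]

theorem norm_trace_fibMat (hz : ‖z‖ = 1) (k : ℕ) :
    ‖(fibMat (walkMat θa θb z) k).trace‖ = 2 * ‖halfTrace θa θb z k‖ := by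
  have hz0 : z ≠ 0 := norm_ne_zero_iff.1 (by rw [hz]; exact one_ne_zero)
  rw [halfTrace, blockWord, transferWord_flatMap hz0, trace_smul, norm_mul, norm_smul, norm_pow, hz]
  simp [fibMat]

theorem transferN_succ (ω : ℤ → Letter) (n : ℕ) :
    transferN θa θb z ω (n + 1) =
      transfer z (verblunsky θa θb ω n) * transferN θa θb z ω n := by
  simp [transferN, List.range_succ, transferWord_append, transferWord]

theorem transferN_two_mul (hz : z ≠ 0) (ω : ℤ → Letter) (n : ℕ) :
    transferN θa θb z ω (2 * n) = z ^ n • wordMat (walkMat θa θb z) (window ω 0 n) := by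
  induction n with
  | zero => simp [transferN, transferWord, window]
  | succ n ih =>
    rw [show 2 * (n + 1) = 2 * n + 1 + 1 by ring, transferN_succ, transferN_succ, ih, ← mul_assoc]
    push_cast
    rw [verblunsky_two_mul, verblunsky_two_mul_add_one, transfer_mul_transfer hz, window_succ,
      wordMat_append]
    simp [pow_succ', smul_smul, mul_comm z]

/-- A point of the unit circle with bounded traces has transfer matrices that grow at most by a
fixed factor for each doubling of the length. -/
theorem exists_norm_transferN_le {m : ℝ} (hA : ∀ l, (walkMat θa θb z l).det = 1) (hz : ‖z‖ = 1)
    (hm : 1 ≤ m) (ht : ∀ k, ‖halfTrace θa θb z k‖ ≤ m) :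
    ∃ D : ℝ, 0 < D ∧ ∀ ω ∈ Omega, ∀ n j : ℕ, n < 2 ^ j →
      ‖transferN θa θb z ω n‖ ≤ D * (((2 * m + 1) ^ 2) ^ 6) ^ j := by
  have hz0 : z ≠ 0 := norm_ne_zero_iff.1 (by rw [hz]; exact one_ne_zero)
  set A := walkMat θa θb z
  set D₀ := (1 + ‖A .a‖) * (1 + ‖A .b‖) *
    (1 + ‖fibMat A 0‖ + ‖fibMat A 1‖ + ‖fibMat A 0 * fibMat A 1‖)
  set Q := 1 + ‖transfer z (letterSin θa θb .a)‖ + ‖transfer z (letterSin θa θb .b)‖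
  have hQ1 : 1 ≤ Q := by
    linarith [norm_nonneg (transfer z (letterSin θa θb .a)),
      norm_nonneg (transfer z (letterSin θa θb .b))]
  have hQ : ∀ l, ‖transfer z (letterSin θa θb l)‖ ≤ Q := fun l => by
    cases l <;> linarith [norm_nonneg (transfer z (letterSin θa θb .a)),
      norm_nonneg (transfer z (letterSin θa θb .b))]
  have hD₀ : 0 < D₀ := by positivity
  refine ⟨Q * D₀, by positivity, fun ω hω n j hn => ?_⟩
  have heven : ∀ ℓ : ℕ, ℓ ≤ n →
      ‖transferN θa θb z ω (2 * ℓ)‖ ≤ D₀ * (((2 * m + 1) ^ 2) ^ 6) ^ j := fun ℓ hℓ => by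
    rw [transferN_two_mul hz0, norm_smul, norm_pow, hz, one_pow, one_mul]
    exact (isFactor_window hω 0 ℓ).norm_wordMat_le hA hm
      (fun k => by rw [norm_trace_fibMat hz]; linarith [ht k]) j (by rw [length_window]; omega)
  rw [mul_assoc]
  obtain ⟨ℓ, rfl | rfl⟩ := Nat.even_or_odd' n
  · exact (heven ℓ (by omega)).trans (le_mul_of_one_le_left (by positivity) hQ1)
  · rw [transferN_succ]
    push_cast
    rw [verblunsky_two_mul]
    exact (norm_mul_le _ _).trans (mul_le_mul (hQ _) (heven ℓ (by omega)) (norm_nonneg _)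
      (by linarith))

theorem one_le_traceBound : 1 ≤ traceBound θa θb z := le_max_left _ _

theorem sq_le_constK : (2 * traceBound θa θb z + 1) ^ 2 ≤ constK θa θb z := by
  have hm : 1 ≤ traceBound θa θb z := one_le_traceBound
  refine le_trans ?_ (mul_le_mul_of_nonneg_right
    ((le_max_left _ _).trans ((le_max_left _ _).trans (le_max_left _ _))) (by linarith))
  nlinarith

theorem localNorm_le {ξ : ℕ → ℂ} {L X : ℝ} (hL : 1 ≤ L) (hX : 0 ≤ X)
    (h : ∀ n ≤ ⌊L⌋₊ + 1, ‖ξ n‖ ≤ X) : localNorm ξ L ≤ 2 * X * L := by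
  have hfl : (⌊L⌋₊ : ℝ) ≤ L := Nat.floor_le (by linarith)
  have hfl' : L - ⌊L⌋₊ ≤ 1 := by linarith [Nat.lt_floor_add_one L]
  have hsq : ∀ n ≤ ⌊L⌋₊ + 1, ‖ξ n‖ ^ 2 ≤ X ^ 2 := fun n hn =>
    pow_le_pow_left₀ (norm_nonneg _) (h n hn) 2
  refine Real.sqrt_le_iff.2 ⟨by positivity, ?_⟩
  calc _ ≤ ((⌊L⌋₊ + 1 : ℕ) : ℝ) * X ^ 2 + 1 * X ^ 2 := by
        refine add_le_add ?_ (mul_le_mul hfl' (hsq _ le_rfl) (sq_nonneg _) zero_le_one)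
        refine (Finset.sum_le_card_nsmul _ _ (X ^ 2) fun n hn => hsq n ?_).trans_eq (by simp)
        exact (Finset.mem_range.1 hn).le
    _ = (⌊L⌋₊ + 2) * X ^ 2 := by push_cast; ring
    _ ≤ (4 * L ^ 2) * X ^ 2 := by
        gcongr
        nlinarith
    _ = _ := by ring

/-- Along a dyadic scale below `L`, powers of a number are powers of `L`. -/
theorem pow_log_floor_le_rpow {K L : ℝ} (hK : 1 ≤ K) (hL : 1 ≤ L) :
    (K ^ 8) ^ Nat.log 2 ⌊L⌋₊ ≤ L ^ (2 * (4 * Real.logb 2 K)) := by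
  have hfl : ⌊L⌋₊ ≠ 0 := (Nat.floor_pos.2 hL).ne'
  have h₁ : ((2 : ℝ) ^ Nat.log 2 ⌊L⌋₊) ≤ L := by
    refine le_trans ?_ (Nat.floor_le (by linarith))
    exact_mod_cast Nat.pow_log_le_self 2 hfl
  have hlog : 0 ≤ Real.logb 2 K := Real.logb_nonneg (by norm_num) hK
  calc (K ^ 8) ^ Nat.log 2 ⌊L⌋₊ = ((2 : ℝ) ^ Nat.log 2 ⌊L⌋₊) ^ (2 * (4 * Real.logb 2 K)) := by
        nth_rewrite 1 [← Real.rpow_logb (by norm_num : (0 : ℝ) < 2) (by norm_num)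
          (by linarith : 0 < K)]
        rw [← Real.rpow_natCast, ← Real.rpow_natCast, ← Real.rpow_natCast,
          ← Real.rpow_mul (by positivity), ← Real.rpow_mul (by positivity),
          ← Real.rpow_mul (by positivity)]
        congr 1
        push_cast
        ring
    _ ≤ _ := Real.rpow_le_rpow (by positivity) h₁ (by positivity)

end Growth

end FibCMV

end

theorem mainTheorem8 (θa θb : ℝ)
    (hθa : θa ∈ Set.Ioo (-(Real.pi / 2)) (Real.pi / 2))
    (hθb : θb ∈ Set.Ioo (-(Real.pi / 2)) (Real.pi / 2))
    (z : ℂ) (hz : z ∈ FibCMV.walkSpectrum θa θb) :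
    BddAbove (Set.range fun k : ℕ => ‖FibCMV.halfTrace θa θb z k‖) ∧
    ∃ C₂ : ℝ, 0 < C₂ ∧
      ∀ ω ∈ FibCMV.Omega, ∀ ξ ζ : ℕ → ℂ,
        ‖ξ 0‖ = 1 → ‖ζ 0‖ = 1 →
        (∀ n : ℕ, ![ξ n, ζ n] =
          (FibCMV.transferN θa θb z ω n).mulVec ![ξ 0, ζ 0]) →
        ∀ L : ℝ, 1 ≤ L →
          FibCMV.localNorm ξ L ≤ C₂ * L ^ (2 * FibCMV.gammaTwo θa θb z + 1) := by
  have hz1 := FibCMV.norm_eq_one_of_mem_walkSpectrum hz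
  have hz0 : z ≠ 0 := norm_ne_zero_iff.1 (by rw [hz1]; exact one_ne_zero)
  have hbdd : BddAbove (Set.range fun k : ℕ => ‖FibCMV.halfTrace θa θb z k‖) := by
    obtain ⟨M, hM⟩ := FibCMV.bddAbove_trace_of_mem_walkSpectrum hθa hθb hz
    refine ⟨M, ?_⟩
    rintro _ ⟨k, rfl⟩
    have h : ‖_‖ ≤ M := hM ⟨k, rfl⟩
    rw [FibCMV.norm_trace_fibMat hz1] at h
    linarith [norm_nonneg (FibCMV.halfTrace θa θb z k)]
  refine ⟨hbdd, ?_⟩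
  set m := FibCMV.traceBound θa θb z with hm
  set K := FibCMV.constK θa θb z with hK
  have hm1 : 1 ≤ m := FibCMV.one_le_traceBound
  have hmK : (2 * m + 1) ^ 2 ≤ K := FibCMV.sq_le_constK
  have hK1 : 1 ≤ K := by nlinarith
  obtain ⟨D, hD, hgrowth⟩ := FibCMV.exists_norm_transferN_le (FibCMV.det_walkMat hθa hθb hz0) hz1
    hm1 fun k => (le_ciSup hbdd k).trans (le_max_right _ _)
  refine ⟨2 * (D * (K ^ 8) ^ 2), by positivity, fun ω hω ξ ζ hξ hζ hsol L hL => ?_⟩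
  have hL0 : 0 < L := by linarith
  set i := Nat.log 2 ⌊L⌋₊
  -- Any `n ≤ ⌊L⌋ + 1` is below `2 ^ (i + 2)`, and `2 ^ i ≤ L`.
  have hbound : ∀ n ≤ ⌊L⌋₊ + 1, ‖ξ n‖ ≤ D * (K ^ 8) ^ (i + 2) := fun n hn => by
    have hi : n < 2 ^ (i + 2) := by
      have : ⌊L⌋₊ < 2 ^ (i + 1) := Nat.lt_pow_succ_log_self (by norm_num) _
      have : 2 ^ (i + 2) = 2 * 2 ^ (i + 1) := by ring
      have : 0 < 2 ^ (i + 1) := by positivity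
      omega
    have h₀ : ‖![ξ 0, ζ 0]‖ ≤ 1 := by
      rw [pi_norm_le_iff_of_nonneg zero_le_one]
      intro j
      fin_cases j
      · exact hξ.le
      · exact hζ.le
    calc ‖ξ n‖ ≤ ‖![ξ n, ζ n]‖ := norm_le_pi_norm ![ξ n, ζ n] 0
      _ ≤ ‖FibCMV.transferN θa θb z ω n‖ * 1 := by
        rw [hsol n]
        exact (Matrix.linfty_opNorm_mulVec _ _).trans (by gcongr)
      _ ≤ D * (((2 * m + 1) ^ 2) ^ 6) ^ (i + 2) := by
        rw [mul_one]
        exact hgrowth ω hω n _ hi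
      _ ≤ D * (K ^ 8) ^ (i + 2) := by
        gcongr
        calc ((2 * m + 1) ^ 2) ^ 6 ≤ K ^ 6 := by gcongr
          _ ≤ K ^ 8 := pow_le_pow_right₀ hK1 (by norm_num)
  calc FibCMV.localNorm ξ L ≤ 2 * (D * (K ^ 8) ^ (i + 2)) * L :=
        FibCMV.localNorm_le hL (by positivity) hbound
    _ = 2 * (D * (K ^ 8) ^ 2) * (K ^ 8) ^ i * L := by ring
    _ ≤ 2 * (D * (K ^ 8) ^ 2) * L ^ (2 * (4 * Real.logb 2 K)) * L := by
        gcongr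
        exact FibCMV.pow_log_floor_le_rpow hK1 hL
    _ = 2 * (D * (K ^ 8) ^ 2) * L ^ (2 * FibCMV.gammaTwo θa θb z + 1) := by
        rw [Real.rpow_add_one hL0.ne', mul_assoc]
        rfl
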